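/- **Setting.** Let $\mathcal X$ be a finite state space and $\mathcal A$ a finite action space with $|\mathcal A|\ge 2$, $p(\cdot\mid x,a)$ the transition probabilities and $r(x,a)\in[0,1]$ the rewards. The MDP is linear: there are features $\varphi:\mathcal X\times\mathcal A\to\mathbb R^d$, $\psi:\mathcal X\to\mathbb R^d$ and $\omega\in\mathbb R^d$ with $r(x,a)=\langle\varphi(x,a),\omega\rangle$, $p(x'\mid x,a)=\langle\varphi(x,a),\psi(x')\rangle$, $\|\varphi(x,a)\|_2\le D_\varphi$, $\|\omega\|_2\le D_\omega$ and $\|\sum_{x'}\psi(x')\|_2\le D_\psi$. The average reward $\rho^\pi=\liminf_{N}\frac1N\mathbb E_\pi[\sum_{t=1}^N r(x_t,a_t)\mid x_1=x]$ of every stationary policy $\pi$ does not depend on $x$, and the Bellman equations $q(x,a)=r(x,a)-\rho^\pi+\sum_{x'}p(x'\mid x,a)\sum_{a'}\pi(a'\mid x')q(x',a')$ have for every $\pi$ a solution with $\sup q-\inf q<D_q$, where $D_q\ge 1$. For each $\pi$ let $\mu^\pi$ be an occupancy measure, $\mu^\pi(x,a)=\pi(a\mid x)\nu^\pi(x)$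 with $\nu^\pi$ a stationary distribution of the chain induced by $\pi$. Fix a behavior policy $\pi_B$ for which $\Lambda=\mathbb E_{(X,A)\sim\mu^{\pi_B}}[\varphi(X,A)\varphi(X,A)^{\mathsf T}]$ is invertible, a comparator policy $\pi^*$, an exponent $c\in\{1/2,1\}$, and put $$C_{\varphi,c}(\pi^*;\pi_B)=\mathbb E_{\mu^{\pi^*}}[\varphi]^{\mathsf T}\Lambda^{-2c}\,\mathbb E_{\mu^{\pi^*}}[\varphi].$$ **Algorithm.** Inputs: $T,K\ge1$, step sizes $\zeta,\alpha,\xi,\eta>0$, radii $D_\theta,D_\beta$, and initial points $\|\beta_1\|_2\le D_\beta$, $\|\theta_0\|_2\le D_\theta$, $\rho_0\in[0,1]$. Let $\Pi_D$ denote the projection onto the Euclidean ball of radius $D$ and $\pi_t(a\mid x)\propto\exp(\alpha\sum_{k<t}\langle\varphi(x,a),\theta_k\rangle)$. A sample is an independent triple with $(X,A)\sim\mu^{\pi_B}$, $X'\sim p(\cdot\mid X,A)$. In round $t=1,\dots,T$ set $\theta_t^{(1)}=\theta_{t-1}$, $\rho_t^{(1)}=\rho_{t-1}$; for $i=1,\dots,K$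 take a fresh sample, draw $A'\sim\pi_t(\cdot\mid X')$, put $m=\langle\varphi(X,A),\Lambda^{c-1}\beta_t\rangle$ and $$\rho_t^{(i+1)}=\Pi_{[0,1]}\bigl(\rho_t^{(i)}-\xi(1-m)\bigr),\qquad \theta_t^{(i+1)}=\Pi_{D_\theta}\bigl(\theta_t^{(i)}-\eta m(\varphi(X',A')-\varphi(X,A))\bigr).$$ Let $\rho_t=\frac1K\sum_{i\le K}\rho_t^{(i)}$, $\theta_t=\frac1K\sum_{i\le K}\theta_t^{(i)}$, take one more fresh sample and set $$\beta_{t+1}=\Pi_{D_\beta}\Bigl(\beta_t+\zeta\,\Lambda^{c-1}\varphi(X,A)\bigl[r(X,A)+\textstyle\sum_a\pi_t(a\mid X')\langle\varphi(X',a),\theta_t\rangle-\langle\theta_t,\varphi(X,A)\rangle-\rho_t\bigr]\Bigr).$$ Return $\pi_{\rm out}=\pi_J$ with $J$ uniform on $\{1,\dots,T\}$. The number of samples used is $n=T(K+1)$. **Corollary 2.** Let $D_\omega=D_\psi=\sqrt d$. (i) If moreover $\|\sum_x v(x)\psi(x)\|_2\le\sqrt d$ for all $v:\mathcal X\to[-1,1]$,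 then for every $\pi$ there is $\theta^\pi$ with $\|\theta^\pi\|_2\le\sqrt d+1+\sqrt d\,D_q$ such that $q(x,a)=\langle\varphi(x,a),\theta^\pi\rangle$ solves the Bellman equations of $\pi$. (ii) For all constants $B_\varphi,\kappa,\kappa_\theta>0$ there is a constant $C_0$, depending on nothing else, such that the following holds. Assume $D_\varphi\le B_\varphi$; every $\pi$ has a solution $\langle\varphi(\cdot),\theta^\pi\rangle$ of its Bellman equations with $\|\theta^\pi\|_2\le D_\theta$, where $D_\theta\le\kappa_\theta\sqrt d\,D_q$; and $D_\beta=\kappa\, C_{\varphi,c}(\pi^*;\pi_B)^{1/2}$ with $C_{\varphi,c}(\pi^*;\pi_B)\le D_\beta^2$. Then for every $0<\varepsilon\le1$ there are $T,K$ and step sizes, depending only on $c,d,|\mathcal A|,D_\varphi,D_\theta,D_\beta,\varepsilon$, such that for all admissible initial points $$\mathbb E\bigl[\langle\mu^{\pi^*}-\mu^{\pi_{\rm out}},r\rangle\bigr]\le\varepsilon\qquad\text{and}\qquad n\le C_0\,\varepsilon^{-4}D_q^4\,C_{\varphi,c}(\pi^*;\pi_B)^2\,d^{4-2c}\log|\mathcal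 A| .$$ -/

import Mathlib

/-- The parameter space `ℝ^d` with the Euclidean norm. -/
abbrev Vec (d : ℕ) : Type := EuclideanSpace ℝ (Fin d)

/-- Stationary (randomized) policies `π(a | x) = π x a`. -/
abbrev Policy (X A : Type*) [Fintype A] : Type _ := X → stdSimplex ℝ A

/-- Markov decision process with finitely many states and actions and rewards in `[0,1]`;
`p x a x'` is the probability of moving from `x` to `x'` under action `a`. -/
structure MDP (X A : Type*) [Fintype X] where
  p : X → A → stdSimplex ℝ X
  r : X → A → ℝ
  r_mem : ∀ x a, r x a ∈ Set.Icc (0 : ℝ) 1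

/-- The law on a finite type given by a probability vector. -/
noncomputable def simplexPMF {S : Type*} [Fintype S] (μ : stdSimplex ℝ S) : PMF S :=
  PMF.ofFintype (fun s => ENNReal.ofReal (μ s)) (by
    have h0 : ∀ s, 0 ≤ μ s := μ.2.1
    have h1 : ∑ s, μ s = 1 := μ.2.2
    rw [← ENNReal.ofReal_sum_of_nonneg (fun s _ => h0 s), h1, ENNReal.ofReal_one])

/-- Expectation of a real function under a discrete law (below always with finite support). -/
noncomputable def PMF.expect {S : Type*} (P : PMF S) (f : S → ℝ) : ℝ :=
  ∑' s, (P s).toReal * f s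

/-- Real powers of a symmetric positive definite matrix. -/
noncomputable def matPow {d : ℕ} (L : Matrix (Fin d) (Fin d) ℝ) (s : ℝ) :
    Matrix (Fin d) (Fin d) ℝ :=
  cfc (fun z : ℝ => z ^ s) L

/-- Euclidean projection onto the closed ball of radius `D` around the origin. -/
noncomputable def projBall {d : ℕ} (D : ℝ) (z : Vec d) : Vec d :=
  if ‖z‖ ≤ D then z else (D / ‖z‖) • z

/-- Projection onto the interval `[0,1]`. -/
noncomputable def projUnit (z : ℝ) : ℝ := max 0 (min 1 z)

/-- Softmax policy `π(a | x) ∝ exp (α ⟨φ(x,a), s⟩)`. -/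
noncomputable def softmaxPolicy {X A : Type*} [Fintype A] [Nonempty A] {d : ℕ}
    (φ : X → A → Vec d) (α : ℝ) (s : Vec d) : Policy X A := fun x =>
  ⟨fun a => Real.exp (α * inner ℝ (φ x a) s) / ∑ b, Real.exp (α * inner ℝ (φ x b) s),
    fun a => by positivity, by
      rw [← Finset.sum_div]
      exact div_self (Finset.sum_pos (fun b _ => Real.exp_pos _) Finset.univ_nonempty).ne'⟩

namespace MDP

variable {X A : Type*} [Fintype X] [Fintype A]

/-- Expected one-step reward from each state under `π`. -/
noncomputable def rewardOf (M : MDP X A) (π : Policy X A) : X → ℝ :=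
  fun x => ∑ a, π x a * M.r x a

/-- One application of the transition operator of `π` to a function on states. -/
noncomputable def stepOf (M : MDP X A) (π : Policy X A) (f : X → ℝ) : X → ℝ :=
  fun x => ∑ a, π x a * ∑ x', M.p x a x' * f x'

/-- Long-term average reward
`liminf_N (1/N) E_π[∑_{t=1}^N r(x_t,a_t) | x_1 = x]` of `π` from the start state `x`. -/
noncomputable def avgReward (M : MDP X A) (π : Policy X A) (x : X) : ℝ :=
  Filter.liminf
    (fun N : ℕ => (1 / (N : ℝ)) * ∑ t ∈ Finset.range N, ((M.stepOf π)^[t] (M.rewardOf π)) x)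
    Filter.atTop

/-- The Bellman equations `q = r - ρ 1 + P v`, `v(x) = ∑_a π(a|x) q(x,a)`. -/
def IsBellman (M : MDP X A) (π : Policy X A) (ρ : ℝ) (q : X → A → ℝ) : Prop :=
  ∀ x a, q x a = M.r x a - ρ + ∑ x', M.p x a x' * ∑ a', π x' a' * q x' a'

/-- `μ` is an (undiscounted) state-action occupancy measure of `π`: it is `π ∘ ν` for a
stationary state distribution `ν` of the chain induced by `π`. -/
def IsOccupancy (M : MDP X A) (π : Policy X A) (μ : stdSimplex ℝ (X × A)) : Prop :=
  ∃ ν : stdSimplex ℝ X, (∀ x a, μ (x, a) = π x a * ν x) ∧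
    ∀ x', ν x' = ∑ x, ∑ a, μ (x, a) * M.p x a x'

/-- Linear MDP with feature map `φ` and the norm bounds on the vectors describing it. -/
structure IsLinear {d : ℕ} (M : MDP X A) (φ : X → A → Vec d) (ψ : X → Vec d) (ω : Vec d)
    (Dφ Dψ Dω : ℝ) : Prop where
  reward : ∀ x a, M.r x a = inner ℝ (φ x a) ω
  trans : ∀ x a x', M.p x a x' = inner ℝ (φ x a) (ψ x')
  norm_feat : ∀ x a, ‖φ x a‖ ≤ Dφ
  norm_psi : ‖∑ x', ψ x'‖ ≤ Dψ
  norm_omega : ‖ω‖ ≤ Dω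

end MDP

section Coverage

variable {X A : Type*} [Fintype X] [Fintype A] {d : ℕ}

/-- Feature covariance `Λ = E_{(X,A) ∼ μ}[φ(X,A) φ(X,A)ᵀ]`. -/
noncomputable def featCov (φ : X → A → Vec d) (μ : stdSimplex ℝ (X × A)) :
    Matrix (Fin d) (Fin d) ℝ :=
  Matrix.of fun i j => ∑ z : X × A, μ z * (φ z.1 z.2 i * φ z.1 z.2 j)

/-- Mean feature vector `E_{(X,A) ∼ μ}[φ(X,A)]`. -/
noncomputable def meanFeat (φ : X → A → Vec d) (μ : stdSimplex ℝ (X × A)) : Vec d :=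
  ∑ z : X × A, μ z • φ z.1 z.2

/-- Generalized coverage ratio
`C_{φ,c} = E_{μ*}[φ]ᵀ Λ^{-2c} E_{μ*}[φ]`, with `Λ` the feature covariance of `μB`. -/
noncomputable def coverage (φ : X → A → Vec d) (c : ℝ) (μstar μB : stdSimplex ℝ (X × A)) : ℝ :=
  inner ℝ (meanFeat φ μstar)
    (Matrix.toEuclideanLin (matPow (featCov φ μB) (-2 * c)) (meanFeat φ μstar))

end Coverage

/-- Tuning parameters and initial iterates of the offline primal-dual method. -/
structure AlgInput (d : ℕ) where
  /-- exponent of the reparametrization -/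
  c : ℝ
  /-- radius of the feasible ball of `θ` -/
  Dθ : ℝ
  /-- radius of the feasible ball of `β` -/
  Dβ : ℝ
  /-- step size for `β` -/
  ζ : ℝ
  /-- step size for the policy -/
  α : ℝ
  /-- step size for `ρ` -/
  ξ : ℝ
  /-- step size for `θ` -/
  η : ℝ
  /-- number of iterations of each inner loop -/
  K : ℕ+
  β₁ : Vec d
  θ₀ : Vec d
  ρ₀ : ℝ

/-- Variables of the inner loop: the current iterates `θ_t^{(i)}`, `ρ_t^{(i)}` and the sums of
the iterates of index smaller than `i`. -/
structure InnerState (d : ℕ) where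
  θ : Vec d
  ρ : ℝ
  sumθ : Vec d
  sumρ : ℝ

/-- Variables of the outer loop after `t` rounds: `β_{t+1}`, `θ_t`, `ρ_t` and the list
`[θ_1, …, θ_t]`. -/
structure OuterState (d : ℕ) where
  β : Vec d
  θ : Vec d
  ρ : ℝ
  hist : List (Vec d)

section Algorithm

variable {X A : Type*} [Fintype X] [Fintype A] [Nonempty A] {d : ℕ}

/-- Law of one sample transition `(X, A, X')` of the dataset: `(X,A) ∼ μB`, `X' ∼ p(· | X,A)`.
The observed reward is `r(X,A)`. -/
noncomputable def sampleLaw (M : MDP X A) (μB : stdSimplex ℝ (X × A)) : PMF (X × A × X) :=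
  (simplexPMF μB).bind fun z => (simplexPMF (M.p z.1 z.2)).map fun x' => (z.1, z.2, x')

/-- The vector `Λ^{c-1} u`. -/
noncomputable def scaled (φ : X → A → Vec d) (μB : stdSimplex ℝ (X × A)) (c : ℝ) (u : Vec d) :
    Vec d :=
  Matrix.toEuclideanLin (matPow (featCov φ μB) (c - 1)) u

/-- One iteration of the inner loop: draw a fresh sample `(x, a, x')` and `a' ∼ π(· | x')`, and do
one projected stochastic gradient descent step on `ρ` and on `θ`. -/
noncomputable def innerStep (M : MDP X A) (φ : X → A → Vec d) (μB : stdSimplex ℝ (X × A))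
    (I : AlgInput d) (π : Policy X A) (β : Vec d) (s : InnerState d) : PMF (InnerState d) :=
  (sampleLaw M μB).bind fun w => (simplexPMF (π w.2.2)).map fun a' =>
    let f := φ w.1 w.2.1
    let f' := φ w.2.2 a'
    let m : ℝ := inner ℝ f (scaled φ μB I.c β)
    let gρ : ℝ := 1 - m
    let gθ : Vec d := m • f' - m • f
    { θ := projBall I.Dθ (s.θ - I.η • gθ)
      ρ := projUnit (s.ρ - I.ξ * gρ)
      sumθ := s.sumθ + s.θ
      sumρ := s.sumρ + s.ρ }

/-- State of the inner loop after `i` iterations. -/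
noncomputable def innerRun (M : MDP X A) (φ : X → A → Vec d) (μB : stdSimplex ℝ (X × A))
    (I : AlgInput d) (π : Policy X A) (β θ : Vec d) (ρ : ℝ) : ℕ → PMF (InnerState d)
  | 0 => PMF.pure { θ := θ, ρ := ρ, sumθ := 0, sumρ := 0 }
  | i + 1 => (innerRun M φ μB I π β θ ρ i).bind (innerStep M φ μB I π β)

/-- The policy `σ(α ∑_k Φ θ_k)` determined by a list of parameters (uniform for the empty list). -/
noncomputable def policyOf (φ : X → A → Vec d) (α : ℝ) (l : List (Vec d)) : Policy X A :=
  softmaxPolicy φ α l.sum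

/-- One round of the outer loop: `K` inner iterations for the current policy, averaging of the
iterates, then one projected stochastic gradient ascent step on `β` with one further fresh sample.
A round uses `K + 1` sample transitions. -/
noncomputable def outerStep (M : MDP X A) (φ : X → A → Vec d) (μB : stdSimplex ℝ (X × A))
    (I : AlgInput d) (s : OuterState d) : PMF (OuterState d) :=
  let π := policyOf φ I.α s.hist
  (innerRun M φ μB I π s.β s.θ s.ρ I.K).bind fun u =>
    let θt : Vec d := (1 / (I.K : ℝ)) • u.sumθ
    let ρt : ℝ := (1 / (I.K : ℝ)) * u.sumρ
    (sampleLaw M μB).map fun w =>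
      let f := φ w.1 w.2.1
      let v : ℝ := ∑ b, π w.2.2 b * inner ℝ (φ w.2.2 b) θt
      let gβ : Vec d := (M.r w.1 w.2.1 + v - inner ℝ θt f - ρt) • scaled φ μB I.c f
      { β := projBall I.Dβ (s.β + I.ζ • gβ)
        θ := θt
        ρ := ρt
        hist := s.hist ++ [θt] }

/-- State of the outer loop after `t` rounds. -/
noncomputable def outerRun (M : MDP X A) (φ : X → A → Vec d) (μB : stdSimplex ℝ (X × A))
    (I : AlgInput d) : ℕ → PMF (OuterState d)
  | 0 => PMF.pure { β := I.β₁, θ := I.θ₀, ρ := I.ρ₀, hist := [] }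
  | t + 1 => (outerRun M φ μB I t).bind (outerStep M φ μB I)

/-- Law of the output of the method: run `T` rounds, draw `J` uniformly from `{1, …, T}` and
return `π_J = σ(α ∑_{k < J} Φ θ_k)`. Here `j : Fin T` stands for `J - 1`. -/
noncomputable def outputLaw (M : MDP X A) (φ : X → A → Vec d) (μB : stdSimplex ℝ (X × A))
    (I : AlgInput d) (T : ℕ+) : PMF (Policy X A) :=
  (outerRun M φ μB I T).bind fun s =>
    (PMF.uniformOfFintype (Fin T)).map fun j => policyOf φ I.α (s.hist.take j)

end Algorithm

/-- Number of sample transitions used by `T` rounds with inner loops of length `K`. -/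
def numSamples (T K : ℕ+) : ℕ := T * (K + 1)

/-! Let R be the gain of the comparator π⋆. For a policy π put L(β; θ, ρ) = ρ + the mean temporal
difference error under the data law, weighted by ⟨φ, Λ^{c-1}β⟩. Two values of L are explicit. At the
Bellman pair (θ^π, ρ^π) it equals ρ^π for every β (`weightedTD_eq_zero`). At β⋆ = Λ^{-c} E_{μ⋆}[φ]
it equals R + ν⋆(V_π - V_{π⋆}) for every (θ, ρ), because in a linear MDP the mean error is linear in
φ and β⋆ reweights the data law into μ⋆ on such functions (`exists_comparator`,
`weightedTD_comparator`).

Hence R - ρ^{π_t} is the sum of three regrets: L(β_t; θ_t, ρ_t) - L(β_t; θ^{π_t}, ρ^{π_t}), paid by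
the inner loop; L(β⋆; θ_t, ρ_t) - L(β_t; θ_t, ρ_t), paid by the ascent in β; and ν⋆(V_{π⋆} -
V_{π_t}), paid by exponential weights. The first is small in every single round
(`expect_innerRun_average_le`). The other two telescope through a squared distance and a
log-partition potential (`expect_betaStep_le`, `policyPotential_add_le`).
`RegretSetup.expect_outerStep_le` adds all three.

The variances are controlled by E⟨φ, Λ^{c-1}β⟩² ≲ ‖β‖² and E‖Λ^{c-1}φ‖² ≲ d^{2-2c}. With step sizes
of order ε this needs K ≲ d D_q² C/ε² and T ≲ d D_q² C d^{2-2c} log|A|/ε², whose product is the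
claimed bound. Additive constants are absorbed because (1 + D_φ²) C ≥ 1 (`one_le_mul_coverage`) and
log|A| ≥ 1/2. -/

namespace PMF

/-! ### Expectations under finitely supported laws. -/

variable {S R : Type*}

theorem expect_eq_sum {P : PMF S} {F : Finset S} (h : P.support ⊆ F) (f : S → ℝ) :
    P.expect f = ∑ s ∈ F, (P s).toReal * f s := by
  refine tsum_eq_sum fun s hs => ?_
  have : P s = 0 := by
    rw [PMF.apply_eq_zero_iff]
    exact fun h' => hs (Finset.mem_coe.1 (h h'))
  simp [this]

theorem expect_congr {P : PMF S} {f g : S → ℝ} (h : ∀ s ∈ P.support, f s = g s) :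
    P.expect f = P.expect g := by
  refine tsum_congr fun s => ?_
  by_cases hs : s ∈ P.support
  · rw [h s hs]
  · simp [(PMF.apply_eq_zero_iff P s).2 hs]

/-- Finite support matters: a real `tsum` defaults to 0 when it is not summable, which would break
monotonicity. -/
theorem expect_mono {P : PMF S} (hP : P.support.Finite) {f g : S → ℝ}
    (h : ∀ s ∈ P.support, f s ≤ g s) : P.expect f ≤ P.expect g := by
  have hF : P.support ⊆ hP.toFinset := by simp
  rw [expect_eq_sum hF, expect_eq_sum hF]
  refine Finset.sum_le_sum fun s hs => ?_
  exact mul_le_mul_of_nonneg_left (h s (by simpa using hs)) ENNReal.toReal_nonneg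

theorem expect_add {P : PMF S} (hP : P.support.Finite) (f g : S → ℝ) :
    P.expect (fun s => f s + g s) = P.expect f + P.expect g := by
  have hF : P.support ⊆ hP.toFinset := by simp
  simp only [expect_eq_sum hF, mul_add, Finset.sum_add_distrib]

theorem expect_const_mul (P : PMF S) (k : ℝ) (f : S → ℝ) :
    P.expect (fun s => k * f s) = k * P.expect f := by
  simp only [PMF.expect, ← tsum_mul_left]
  exact tsum_congr fun s => by ring

theorem expect_const (P : PMF S) (k : ℝ) : P.expect (fun _ => k) = k := by
  have h : ∑' s, (P s).toReal = 1 := by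
    rw [← ENNReal.tsum_toReal_eq (fun s => P.apply_ne_top s), P.tsum_coe, ENNReal.toReal_one]
  simp only [PMF.expect, tsum_mul_right, h, one_mul]

theorem expect_pure (s : S) (f : S → ℝ) : (PMF.pure s).expect f = f s := by
  rw [expect_eq_sum (F := {s}) (by simp)]
  simp

theorem support_pure_finite (s : S) : (PMF.pure s).support.Finite := by simp

theorem support_bind_finite {P : PMF S} {Q : S → PMF R} (hP : P.support.Finite)
    (hQ : ∀ s, (Q s).support.Finite) : (P.bind Q).support.Finite := by
  rw [PMF.support_bind]
  exact hP.biUnion fun s _ => hQ s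

theorem support_map_finite {P : PMF S} (hP : P.support.Finite) (g : S → R) :
    (P.map g).support.Finite := by
  rw [PMF.support_map]
  exact hP.image g

theorem expect_bind {P : PMF S} {Q : S → PMF R} (hP : P.support.Finite)
    (hQ : ∀ s, (Q s).support.Finite) (f : R → ℝ) :
    (P.bind Q).expect f = P.expect fun s => (Q s).expect f := by
  have hB := support_bind_finite hP hQ
  have hF : P.support ⊆ hP.toFinset := by simp
  have hG : (P.bind Q).support ⊆ hB.toFinset := by simp
  have hQ' : ∀ s ∈ P.support, (Q s).support ⊆ hB.toFinset := fun s hs t ht => by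
    simp only [Set.Finite.coe_toFinset, PMF.mem_support_bind_iff]
    exact ⟨s, hs, ht⟩
  have h1 : P.expect (fun s => (Q s).expect f) =
      P.expect fun s => ∑ t ∈ hB.toFinset, (Q s t).toReal * f t :=
    expect_congr fun s hs => expect_eq_sum (hQ' s hs) f
  rw [h1, expect_eq_sum hG, expect_eq_sum hF]
  simp only [Finset.mul_sum]
  rw [Finset.sum_comm]
  refine Finset.sum_congr rfl fun t _ => ?_
  have h2 : (P.bind Q) t = ∑ s ∈ hP.toFinset, P s * Q s t := by
    rw [PMF.bind_apply]
    refine tsum_eq_sum fun s hs => ?_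
    have : P s = 0 := by
      rw [PMF.apply_eq_zero_iff]
      simpa using hs
    simp [this]
  rw [h2, ENNReal.toReal_sum (fun s _ => ENNReal.mul_ne_top (P.apply_ne_top s)
    ((Q s).apply_ne_top t)), Finset.sum_mul]
  exact Finset.sum_congr rfl fun s _ => by rw [ENNReal.toReal_mul]; ring

theorem expect_map {P : PMF S} (hP : P.support.Finite) (g : S → R) (f : R → ℝ) :
    (P.map g).expect f = P.expect fun s => f (g s) := by
  rw [PMF.map, expect_bind (Q := pure ∘ g) hP fun s => support_pure_finite (g s)]
  simp only [Function.comp_apply, expect_pure]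

end PMF

/-! ### Averages over probability vectors. -/

section FiniteLaws

variable {S : Type*} [Fintype S]

theorem support_simplexPMF_finite (μ : stdSimplex ℝ S) : (simplexPMF μ).support.Finite :=
  Set.toFinite _

theorem expect_simplexPMF (μ : stdSimplex ℝ S) (f : S → ℝ) :
    (simplexPMF μ).expect f = ∑ s, μ s * f s := by
  rw [PMF.expect_eq_sum (F := Finset.univ) (by simp)]
  refine Finset.sum_congr rfl fun s _ => ?_
  have h : 0 ≤ μ s := μ.2.1 s
  rw [simplexPMF, PMF.ofFintype_apply, ENNReal.toReal_ofReal h]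

theorem expect_uniformOfFintype [Nonempty S] (f : S → ℝ) :
    (PMF.uniformOfFintype S).expect f = (Fintype.card S : ℝ)⁻¹ * ∑ s, f s := by
  rw [PMF.expect_eq_sum (F := Finset.univ) (by simp), Finset.mul_sum]
  simp

theorem stdSimplex_nonneg (μ : stdSimplex ℝ S) (s : S) : 0 ≤ μ s := μ.2.1 s

theorem stdSimplex_sum (μ : stdSimplex ℝ S) : ∑ s, μ s = 1 := μ.2.2

theorem stdSimplex_sum_mul_const (μ : stdSimplex ℝ S) (k : ℝ) : ∑ s, μ s * k = k := by
  rw [← Finset.sum_mul, stdSimplex_sum, one_mul]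

theorem stdSimplex_sum_mul_le (μ : stdSimplex ℝ S) {f : S → ℝ} {k : ℝ} (h : ∀ s, f s ≤ k) :
    ∑ s, μ s * f s ≤ k :=
  (Finset.sum_le_sum fun s _ => mul_le_mul_of_nonneg_left (h s) (stdSimplex_nonneg μ s)).trans_eq
    (stdSimplex_sum_mul_const μ k)

theorem le_stdSimplex_sum_mul (μ : stdSimplex ℝ S) {f : S → ℝ} {k : ℝ} (h : ∀ s, k ≤ f s) :
    k ≤ ∑ s, μ s * f s :=
  (stdSimplex_sum_mul_const μ k).symm.trans_le
    (Finset.sum_le_sum fun s _ => mul_le_mul_of_nonneg_left (h s) (stdSimplex_nonneg μ s))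

theorem abs_stdSimplex_sum_mul_le (μ : stdSimplex ℝ S) {f : S → ℝ} {k : ℝ} (h : ∀ s, |f s| ≤ k) :
    |∑ s, μ s * f s| ≤ k :=
  abs_le.2 ⟨le_stdSimplex_sum_mul μ fun s => (abs_le.1 (h s)).1,
    stdSimplex_sum_mul_le μ fun s => (abs_le.1 (h s)).2⟩

end FiniteLaws

/-! ### The law of one sample transition. -/

section SampleLaw

variable {X A : Type*} [Fintype X] [Fintype A]

theorem support_sampleLaw_finite (M : MDP X A) (μB : stdSimplex ℝ (X × A)) :
    (sampleLaw M μB).support.Finite := Set.toFinite _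

theorem expect_sampleLaw (M : MDP X A) (μB : stdSimplex ℝ (X × A)) (f : X × A × X → ℝ) :
    (sampleLaw M μB).expect f = ∑ z, μB z * ∑ x', M.p z.1 z.2 x' * f (z.1, z.2, x') := by
  rw [sampleLaw, PMF.expect_bind (support_simplexPMF_finite _) fun z => Set.toFinite _,
    expect_simplexPMF]
  refine Finset.sum_congr rfl fun z _ => ?_
  rw [PMF.expect_map (support_simplexPMF_finite _), expect_simplexPMF]

end SampleLaw

/-! ### Real powers of positive definite matrices. -/

section MatrixPowers

variable {d : ℕ} {L : Matrix (Fin d) (Fin d) ℝ}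

theorem spectrum_pos_of_posDef (hL : L.PosDef) {z : ℝ} (hz : z ∈ spectrum ℝ L) : 0 < z := by
  rw [hL.1.spectrum_real_eq_range_eigenvalues] at hz
  obtain ⟨i, rfl⟩ := hz
  exact hL.eigenvalues_pos i

theorem continuousOn_rpow_spectrum (hL : L.PosDef) (s : ℝ) :
    ContinuousOn (fun z : ℝ => z ^ s) (spectrum ℝ L) := fun z hz =>
  (Real.continuousAt_rpow_const z s (Or.inl (spectrum_pos_of_posDef hL hz).ne')).continuousWithinAt

/-- All eigenvalues are positive, so z^s z^t = z^{s+t} on the spectrum, and the functional calculus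
transports this. Every later cancellation of powers of Λ rests on it. -/
theorem matPow_mul (hL : L.PosDef) (s t : ℝ) : matPow L s * matPow L t = matPow L (s + t) := by
  rw [matPow, matPow, matPow, ← cfc_mul _ _ L (continuousOn_rpow_spectrum hL s)
    (continuousOn_rpow_spectrum hL t)]
  exact cfc_congr fun z hz => (Real.rpow_add (spectrum_pos_of_posDef hL hz) s t).symm

theorem matPow_one (hL : L.PosDef) : matPow L 1 = L := by
  have : IsSelfAdjoint L := hL.1
  simp only [matPow, Real.rpow_one]
  exact cfc_id' ℝ L

theorem matPow_zero (hL : L.PosDef) : matPow L 0 = 1 := by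
  have : IsSelfAdjoint L := hL.1
  simp only [matPow, Real.rpow_zero]
  exact cfc_const_one ℝ L

theorem isHermitian_matPow (s : ℝ) : (matPow L s).IsHermitian :=
  cfc_predicate (p := IsSelfAdjoint) _ L

theorem inner_toEuclideanLin_comm {B : Matrix (Fin d) (Fin d) ℝ} (hB : B.IsHermitian)
    (u v : Vec d) :
    inner ℝ (Matrix.toEuclideanLin B u) v = inner ℝ u (Matrix.toEuclideanLin B v) :=
  (Matrix.isSymmetric_toEuclideanLin_iff.2 hB) u v

theorem toEuclideanLin_mul_apply (B C : Matrix (Fin d) (Fin d) ℝ) (u : Vec d) :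
    Matrix.toEuclideanLin (B * C) u = Matrix.toEuclideanLin B (Matrix.toEuclideanLin C u) := by
  ext i
  simp [Matrix.mulVec_mulVec]

theorem toEuclideanLin_one_apply (u : Vec d) :
    Matrix.toEuclideanLin (1 : Matrix (Fin d) (Fin d) ℝ) u = u := by
  ext i
  simp

end MatrixPowers

/-! ### Feature covariance, second moments and the coverage ratio. -/

section Covariance

open scoped Matrix

variable {X A : Type*} [Fintype X] [Fintype A] {d : ℕ}

theorem toEuclideanLin_featCov (φ : X → A → Vec d) (μ : stdSimplex ℝ (X × A)) (v : Vec d) :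
    Matrix.toEuclideanLin (featCov φ μ) v =
      ∑ z : X × A, (μ z * inner ℝ (φ z.1 z.2) v) • φ z.1 z.2 := by
  ext i
  simp only [Matrix.toLpLin_apply, Matrix.mulVec, dotProduct, featCov, Matrix.of_apply,
    PiLp.inner_apply, RCLike.inner_apply, conj_trivial, WithLp.ofLp_sum, Finset.sum_apply,
    PiLp.smul_apply, smul_eq_mul, Finset.mul_sum, Finset.sum_mul]
  rw [Finset.sum_comm]
  exact Finset.sum_congr rfl fun z _ => Finset.sum_congr rfl fun j _ => by ring

/-- The dictionary between second moments of linear functions of φ and the bilinear form of Λ. -/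
theorem inner_featCov (φ : X → A → Vec d) (μ : stdSimplex ℝ (X × A)) (u v : Vec d) :
    inner ℝ u (Matrix.toEuclideanLin (featCov φ μ) v) =
      ∑ z : X × A, μ z * (inner ℝ (φ z.1 z.2) u * inner ℝ (φ z.1 z.2) v) := by
  rw [toEuclideanLin_featCov, inner_sum]
  refine Finset.sum_congr rfl fun z _ => ?_
  rw [real_inner_smul_right, real_inner_comm u]
  ring

theorem isHermitian_featCov (φ : X → A → Vec d) (μ : stdSimplex ℝ (X × A)) :
    (featCov φ μ).IsHermitian := by
  ext i j
  simp [featCov, mul_comm]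

/-- The quadratic form of Λ is an average of squares, and a positive semidefinite matrix that is
invertible is definite. -/
theorem posDef_featCov {φ : X → A → Vec d} {μ : stdSimplex ℝ (X × A)}
    (h : IsUnit (featCov φ μ)) : (featCov φ μ).PosDef := by
  refine (Matrix.PosSemidef.posDef_iff_isUnit ?_).2 h
  refine .of_dotProduct_mulVec_nonneg (isHermitian_featCov φ μ) fun x => ?_
  have h1 := inner_featCov φ μ (WithLp.toLp 2 x) (WithLp.toLp 2 x)
  have h2 : star x ⬝ᵥ featCov φ μ *ᵥ x = inner ℝ (WithLp.toLp 2 x : Vec d)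
      (Matrix.toEuclideanLin (featCov φ μ) (WithLp.toLp 2 x)) := by
    simp [Matrix.toLpLin_apply, EuclideanSpace.inner_eq_star_dotProduct, dotProduct_comm]
  rw [h2, h1]
  exact Finset.sum_nonneg fun z _ => mul_nonneg (stdSimplex_nonneg μ z) (mul_self_nonneg _)

theorem sum_inner_toEuclideanLin_eq_trace (φ : X → A → Vec d) (μ : stdSimplex ℝ (X × A))
    (B : Matrix (Fin d) (Fin d) ℝ) :
    ∑ z : X × A, μ z * inner ℝ (φ z.1 z.2) (Matrix.toEuclideanLin B (φ z.1 z.2)) =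
      (B * featCov φ μ).trace := by
  simp only [Matrix.toLpLin_apply, Matrix.mulVec, dotProduct, featCov, Matrix.of_apply,
    PiLp.inner_apply, RCLike.inner_apply, conj_trivial, Matrix.trace, Matrix.diag_apply,
    Matrix.mul_apply, Finset.mul_sum, Finset.sum_mul]
  rw [Finset.sum_comm]
  refine Finset.sum_congr rfl fun i _ => ?_
  rw [Finset.sum_comm]
  exact Finset.sum_congr rfl fun j _ => Finset.sum_congr rfl fun z _ => by ring

theorem scaled_comm (φ : X → A → Vec d) (μ : stdSimplex ℝ (X × A)) (c : ℝ) (u v : Vec d) :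
    inner ℝ (scaled φ μ c u) v = inner ℝ u (scaled φ μ c v) :=
  inner_toEuclideanLin_comm (isHermitian_matPow _) u v

theorem scaled_one {φ : X → A → Vec d} {μ : stdSimplex ℝ (X × A)} (h : IsUnit (featCov φ μ))
    (u : Vec d) : scaled φ μ 1 u = u := by
  rw [scaled, sub_self, matPow_zero (posDef_featCov h), toEuclideanLin_one_apply]

theorem inner_sq_le_of_norm_le {u v : Vec d} {D : ℝ} (h : ‖u‖ ≤ D) :
    inner ℝ u v * inner ℝ u v ≤ D ^ 2 * ‖v‖ ^ 2 := by
  have h1 := abs_real_inner_le_norm u v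
  have h2 : ‖u‖ * ‖v‖ ≤ D * ‖v‖ := mul_le_mul_of_nonneg_right h (norm_nonneg v)
  rw [← abs_mul_abs_self (inner ℝ u v), ← mul_pow, sq]
  exact mul_self_le_mul_self (abs_nonneg _) (h1.trans h2)

/-- Second moment of the importance weight `⟨φ, Λ^{c-1} β⟩`. -/
theorem sum_sq_inner_scaled_le {φ : X → A → Vec d} {μ : stdSimplex ℝ (X × A)} {c D : ℝ}
    (h : IsUnit (featCov φ μ)) (hc : c = 1 / 2 ∨ c = 1) (hφ : ∀ x a, ‖φ x a‖ ≤ D) (β : Vec d) :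
    ∑ z : X × A, μ z * inner ℝ (φ z.1 z.2) (scaled φ μ c β) ^ 2 ≤ (1 + D ^ 2) * ‖β‖ ^ 2 := by
  have hpd := posDef_featCov h
  have hβ := sq_nonneg ‖β‖
  -- For c = 1/2 the moment is βᵀΛ^{-1/2}ΛΛ^{-1/2}β = ‖β‖²; for c = 1 Cauchy–Schwarz gives D²‖β‖².
  -- The factor 1 + D² covers both.
  rcases hc with rfl | rfl
  · have h1 : ∑ z : X × A, μ z * inner ℝ (φ z.1 z.2) (scaled φ μ (1 / 2) β) ^ 2 = ‖β‖ ^ 2 := by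
      simp only [sq (inner ℝ _ _), ← inner_featCov]
      rw [scaled_comm]
      simp only [scaled]
      rw [← toEuclideanLin_mul_apply, ← toEuclideanLin_mul_apply]
      nth_rewrite 2 [← matPow_one hpd]
      rw [matPow_mul hpd, matPow_mul hpd]
      norm_num
      rw [matPow_zero hpd, toEuclideanLin_one_apply, real_inner_self_eq_norm_sq]
    rw [h1]
    nlinarith [mul_nonneg (sq_nonneg D) hβ]
  · simp only [scaled_one h]
    refine (stdSimplex_sum_mul_le μ fun z => ?_).trans
      (mul_le_mul_of_nonneg_right (le_add_of_nonneg_left zero_le_one) hβ)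
    rw [sq]
    exact inner_sq_le_of_norm_le (hφ _ _)

/-- Second moment of the rescaled feature `Λ^{c-1} φ`. -/
theorem sum_norm_sq_scaled_le {φ : X → A → Vec d} {μ : stdSimplex ℝ (X × A)} {c D : ℝ}
    (h : IsUnit (featCov φ μ)) (hc : c = 1 / 2 ∨ c = 1) (hφ : ∀ x a, ‖φ x a‖ ≤ D) :
    ∑ z : X × A, μ z * ‖scaled φ μ c (φ z.1 z.2)‖ ^ 2 ≤ (1 + D ^ 2) * (d : ℝ) ^ (2 - 2 * c) := by
  have hpd := posDef_featCov h
  -- For c = 1/2 the moment is tr(Λ^{-1}Λ) = d; for c = 1 it is at most D², and d^{2-2c} = 1.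
  rcases hc with rfl | rfl
  · have h1 : ∑ z : X × A, μ z * ‖scaled φ μ (1 / 2) (φ z.1 z.2)‖ ^ 2 = d := by
      have h2 : ∀ u : Vec d, ‖scaled φ μ (1 / 2) u‖ ^ 2 =
          inner ℝ u (Matrix.toEuclideanLin (matPow (featCov φ μ) (-1)) u) := fun u => by
        rw [← real_inner_self_eq_norm_sq, scaled_comm]
        simp only [scaled]
        rw [← toEuclideanLin_mul_apply, matPow_mul hpd]
        norm_num
      simp only [h2]
      rw [sum_inner_toEuclideanLin_eq_trace]
      nth_rewrite 2 [← matPow_one hpd]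
      rw [matPow_mul hpd]
      norm_num
      rw [matPow_zero hpd]
      simp
    rw [h1]
    norm_num
    nlinarith [mul_nonneg (sq_nonneg D) (Nat.cast_nonneg (α := ℝ) d)]
  · simp only [scaled_one h]
    norm_num
    refine (stdSimplex_sum_mul_le μ fun z => ?_).trans (le_add_of_nonneg_left zero_le_one)
    exact pow_le_pow_left₀ (norm_nonneg _) (hφ _ _) 2

/-- The comparator `β⋆ = Λ^{-c} E_{μ⋆}[φ]`: its squared norm is the coverage ratio and the induced
importance weights transport `μB` to `μ⋆` on linear functions of the features. -/
theorem exists_comparator {φ : X → A → Vec d} {μB : stdSimplex ℝ (X × A)}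
    (h : IsUnit (featCov φ μB)) (c : ℝ) (μstar : stdSimplex ℝ (X × A)) :
    ∃ β : Vec d, ‖β‖ ^ 2 = coverage φ c μstar μB ∧
      ∀ u : Vec d, ∑ z : X × A, μB z * (inner ℝ (φ z.1 z.2) (scaled φ μB c β) *
        inner ℝ (φ z.1 z.2) u) = ∑ z : X × A, μstar z * inner ℝ (φ z.1 z.2) u := by
  have hpd := posDef_featCov h
  refine ⟨Matrix.toEuclideanLin (matPow (featCov φ μB) (-c)) (meanFeat φ μstar), ?_, fun u => ?_⟩
  · rw [← real_inner_self_eq_norm_sq, inner_toEuclideanLin_comm (isHermitian_matPow _),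
      ← toEuclideanLin_mul_apply, matPow_mul hpd, coverage]
    ring_nf
  -- The powers of Λ cancel: 1 + (c - 1) + (-c) = 0.
  · rw [← inner_featCov, scaled, ← inner_toEuclideanLin_comm (isHermitian_featCov φ μB),
      ← toEuclideanLin_mul_apply, ← toEuclideanLin_mul_apply]
    nth_rewrite 1 [← matPow_one hpd]
    rw [matPow_mul hpd, matPow_mul hpd]
    norm_num
    rw [matPow_zero hpd, toEuclideanLin_one_apply, meanFeat, sum_inner]
    exact Finset.sum_congr rfl fun z _ => real_inner_smul_left _ _ _

/-- If constants are linear in the features, the coverage ratio is bounded away from zero. -/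
theorem one_le_mul_coverage {φ : X → A → Vec d} {μB : stdSimplex ℝ (X × A)} {c D : ℝ}
    (h : IsUnit (featCov φ μB)) (hc : c = 1 / 2 ∨ c = 1) (hφ : ∀ x a, ‖φ x a‖ ≤ D)
    {w : Vec d} (hw : ∀ x a, inner ℝ (φ x a) w = 1) (μstar : stdSimplex ℝ (X × A)) :
    1 ≤ (1 + D ^ 2) * coverage φ c μstar μB := by
  obtain ⟨β, hβ, hβw⟩ := exists_comparator h c μstar
  have h1 := hβw w
  simp only [hw, mul_one, stdSimplex_sum] at h1
  have h2 := sum_sq_inner_scaled_le h hc hφ β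
  rw [hβ] at h2
  refine le_trans ?_ h2
  -- The weights m have mean 1, since they transport the constant function; then m² ≥ 2m - 1 gives E
  -- m² ≥ 1.
  have h3 : ∑ z : X × A, μB z * (2 * inner ℝ (φ z.1 z.2) (scaled φ μB c β) - 1) = 1 := by
    simp only [mul_sub, mul_one, Finset.sum_sub_distrib, stdSimplex_sum, mul_left_comm _ (2 : ℝ),
      ← Finset.mul_sum, h1]
    norm_num
  rw [← h3]
  refine Finset.sum_le_sum fun z _ => mul_le_mul_of_nonneg_left ?_ (stdSimplex_nonneg μB z)
  nlinarith [sq_nonneg (inner ℝ (φ z.1 z.2) (scaled φ μB c β) - 1)]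

end Covariance

/-! ### Projections do not increase the distance to feasible points. -/

section Projections

variable {d : ℕ}

theorem norm_projBall_le {D : ℝ} (hD : 0 ≤ D) (z : Vec d) : ‖projBall D z‖ ≤ D := by
  unfold projBall
  split_ifs with h
  · exact h
  · have hz : 0 < ‖z‖ := hD.trans_lt (not_le.1 h)
    rw [norm_smul, Real.norm_of_nonneg (by positivity), div_mul_cancel₀ _ hz.ne']

/-- Outside the ball put k = D/‖z‖. Since ⟨z, u⟩ ≤ k‖z‖², the right side exceeds the left by at
least (1 - k)²‖z‖². -/
theorem norm_sq_projBall_sub_le {D : ℝ} {u : Vec d} (hu : ‖u‖ ≤ D) (z : Vec d) :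
    ‖projBall D z - u‖ ^ 2 ≤ ‖z - u‖ ^ 2 := by
  unfold projBall
  split_ifs with h
  · exact le_rfl
  · have hD : 0 ≤ D := (norm_nonneg u).trans hu
    have hz : 0 < ‖z‖ := hD.trans_lt (not_le.1 h)
    obtain ⟨k, hk⟩ : ∃ k, k = D / ‖z‖ := ⟨_, rfl⟩
    have hkD : D = k * ‖z‖ := by rw [hk, div_mul_cancel₀ _ hz.ne']
    have hk0 : 0 ≤ k := by rw [hk]; positivity
    have hk1 : k ≤ 1 := by rw [hk, div_le_one hz]; exact (not_le.1 h).le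
    have hin : inner ℝ z u ≤ ‖z‖ * D :=
      (real_inner_le_norm z u).trans (mul_le_mul_of_nonneg_left hu hz.le)
    rw [← hk, norm_sub_sq_real, norm_sub_sq_real, real_inner_smul_left, norm_smul,
      Real.norm_of_nonneg hk0]
    rw [hkD] at hin
    nlinarith [mul_le_mul_of_nonneg_left hin (sub_nonneg.2 hk1), sq_nonneg ((1 - k) * ‖z‖)]

theorem projUnit_mem (z : ℝ) : projUnit z ∈ Set.Icc (0 : ℝ) 1 :=
  ⟨le_max_left _ _, max_le zero_le_one (min_le_left _ _)⟩

theorem sq_projUnit_sub_le {u : ℝ} (hu : u ∈ Set.Icc (0 : ℝ) 1) (z : ℝ) :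
    (projUnit z - u) ^ 2 ≤ (z - u) ^ 2 := by
  obtain ⟨h0, h1⟩ := hu
  unfold projUnit
  rcases le_total 1 z with h | h
  · rw [min_eq_left h, max_eq_right zero_le_one]
    exact pow_le_pow_left₀ (by linarith) (by linarith) 2
  · rw [min_eq_right h]
    rcases le_total 0 z with h' | h'
    · rw [max_eq_right h']
    · rw [max_eq_left h']
      nlinarith

end Projections

/-! ### Regret of the stochastic gradient descent in (θ, ρ). -/

section InnerLoop

variable {X A : Type*} [Fintype X] [Fintype A] {d : ℕ}

/-- Law of the randomness `((x, a, x'), a')` consumed by one inner iteration. -/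
noncomputable def innerSample (M : MDP X A) (μB : stdSimplex ℝ (X × A)) (π : Policy X A) :
    PMF ((X × A × X) × A) :=
  (sampleLaw M μB).bind fun w => (simplexPMF (π w.2.2)).map fun a' => (w, a')

theorem support_innerSample_finite (M : MDP X A) (μB : stdSimplex ℝ (X × A)) (π : Policy X A) :
    (innerSample M μB π).support.Finite := Set.toFinite _

theorem expect_innerSample (M : MDP X A) (μB : stdSimplex ℝ (X × A)) (π : Policy X A)
    (f : (X × A × X) × A → ℝ) :
    (innerSample M μB π).expect f =
      ∑ z, μB z * ∑ x', M.p z.1 z.2 x' * ∑ a', π x' a' * f ((z.1, z.2, x'), a') := by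
  rw [innerSample, PMF.expect_bind (support_sampleLaw_finite M μB) fun w => Set.toFinite _,
    expect_sampleLaw]
  simp only [PMF.expect_map (support_simplexPMF_finite _), expect_simplexPMF]

/-- Importance weight `⟨φ(x,a), Λ^{c-1} β⟩`. -/
noncomputable def impWeight (φ : X → A → Vec d) (μB : stdSimplex ℝ (X × A)) (c : ℝ) (β : Vec d)
    (z : X × A) : ℝ :=
  inner ℝ (φ z.1 z.2) (scaled φ μB c β)

/-- Mean gradient of the Lagrangian in `θ`, paired with the direction `u`. -/
noncomputable def gradTheta (M : MDP X A) (φ : X → A → Vec d) (μB : stdSimplex ℝ (X × A)) (c : ℝ)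
    (π : Policy X A) (β u : Vec d) : ℝ :=
  (innerSample M μB π).expect fun y =>
    impWeight φ μB c β (y.1.1, y.1.2.1) * inner ℝ (φ y.1.2.2 y.2 - φ y.1.1 y.1.2.1) u

/-- Mean gradient of the Lagrangian in `ρ`. -/
noncomputable def gradRho (φ : X → A → Vec d) (μB : stdSimplex ℝ (X × A)) (c : ℝ) (β : Vec d) : ℝ :=
  1 - ∑ z, μB z * impWeight φ μB c β z

theorem gradTheta_add (M : MDP X A) (φ : X → A → Vec d) (μB : stdSimplex ℝ (X × A)) (c : ℝ)
    (π : Policy X A) (β u v : Vec d) :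
    gradTheta M φ μB c π β (u + v) = gradTheta M φ μB c π β u + gradTheta M φ μB c π β v := by
  simp only [gradTheta, inner_add_right, mul_add]
  exact PMF.expect_add (support_innerSample_finite M μB π) _ _

theorem gradTheta_smul (M : MDP X A) (φ : X → A → Vec d) (μB : stdSimplex ℝ (X × A)) (c : ℝ)
    (π : Policy X A) (β : Vec d) (k : ℝ) (u : Vec d) :
    gradTheta M φ μB c π β (k • u) = k * gradTheta M φ μB c π β u := by
  simp only [gradTheta, real_inner_smul_right]
  rw [← PMF.expect_const_mul]
  exact PMF.expect_congr fun y _ => by ring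

theorem gradTheta_sub (M : MDP X A) (φ : X → A → Vec d) (μB : stdSimplex ℝ (X × A)) (c : ℝ)
    (π : Policy X A) (β u v : Vec d) :
    gradTheta M φ μB c π β (u - v) = gradTheta M φ μB c π β u - gradTheta M φ μB c π β v := by
  rw [sub_eq_add_neg, gradTheta_add, ← neg_one_smul ℝ v, gradTheta_smul]
  ring

theorem expect_innerSample_of_pair (M : MDP X A) (μB : stdSimplex ℝ (X × A)) (π : Policy X A)
    (f : X × A → ℝ) :
    (innerSample M μB π).expect (fun y => f (y.1.1, y.1.2.1)) = ∑ z, μB z * f z := by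
  rw [expect_innerSample]
  simp only [stdSimplex_sum_mul_const]

theorem innerStep_eq_map (M : MDP X A) (φ : X → A → Vec d) (μB : stdSimplex ℝ (X × A))
    (I : AlgInput d) (π : Policy X A) (β : Vec d) (s : InnerState d) :
    innerStep M φ μB I π β s = (innerSample M μB π).map fun y =>
      let f := φ y.1.1 y.1.2.1
      let m : ℝ := impWeight φ μB I.c β (y.1.1, y.1.2.1)
      { θ := projBall I.Dθ (s.θ - I.η • (m • φ y.1.2.2 y.2 - m • f))
        ρ := projUnit (s.ρ - I.ξ * (1 - m))
        sumθ := s.sumθ + s.θ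
        sumρ := s.sumρ + s.ρ } := by
  rw [innerSample, PMF.map_bind]
  simp only [PMF.map_comp]
  rfl

theorem support_innerStep_finite (M : MDP X A) (φ : X → A → Vec d) (μB : stdSimplex ℝ (X × A))
    (I : AlgInput d) (π : Policy X A) (β : Vec d) (s : InnerState d) :
    (innerStep M φ μB I π β s).support.Finite := by
  rw [innerStep_eq_map]
  exact PMF.support_map_finite (support_innerSample_finite M μB π) _

theorem support_innerRun_finite (M : MDP X A) (φ : X → A → Vec d) (μB : stdSimplex ℝ (X × A))
    (I : AlgInput d) (π : Policy X A) (β θ : Vec d) (ρ : ℝ) (i : ℕ) :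
    (innerRun M φ μB I π β θ ρ i).support.Finite := by
  induction i with
  | zero => exact PMF.support_pure_finite _
  | succ i ih => exact PMF.support_bind_finite ih (support_innerStep_finite M φ μB I π β)

/-- Potential of the inner loop with comparators `θ⋆`, `ρ⋆`. -/
noncomputable def innerPotential (M : MDP X A) (φ : X → A → Vec d) (μB : stdSimplex ℝ (X × A))
    (I : AlgInput d) (π : Policy X A) (β θs : Vec d) (ρs : ℝ) (s : InnerState d) : ℝ :=
  gradTheta M φ μB I.c π β s.sumθ + gradRho φ μB I.c β * s.sumρ +
    ‖s.θ - θs‖ ^ 2 / (2 * I.η) + (s.ρ - ρs) ^ 2 / (2 * I.ξ)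

theorem norm_sub_sq_le_of_norm_le {u v : Vec d} {D : ℝ} (hu : ‖u‖ ≤ D) (hv : ‖v‖ ≤ D) :
    ‖u - v‖ ^ 2 ≤ 4 * D ^ 2 := by
  have h : ‖u - v‖ ≤ 2 * D := (norm_sub_le u v).trans (by linarith)
  calc ‖u - v‖ ^ 2 ≤ (2 * D) ^ 2 := pow_le_pow_left₀ (norm_nonneg _) h 2
    _ = 4 * D ^ 2 := by ring

/-- The usual descent inequality: expand the squared distances after dropping the projections. The
samples are unbiased, so the cross terms average to the exact slopes, and the potential's running
sums cancel them at the current iterate. The second-order terms come from ‖φ' - φ‖² ≤ 4D² and (1 -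
m)² ≤ 2 + 2m², averaged using E m² ≤ H. -/
theorem expect_innerStep_innerPotential_le {M : MDP X A} {φ : X → A → Vec d}
    {μB : stdSimplex ℝ (X × A)} {I : AlgInput d} (π : Policy X A) {β θs : Vec d} {ρs D H : ℝ}
    (hη : 0 < I.η) (hξ : 0 < I.ξ) (hφ : ∀ x a, ‖φ x a‖ ≤ D)
    (hH : ∑ z, μB z * impWeight φ μB I.c β z ^ 2 ≤ H)
    (hθs : ‖θs‖ ≤ I.Dθ) (hρs : ρs ∈ Set.Icc (0 : ℝ) 1) (s : InnerState d) :
    (innerStep M φ μB I π β s).expect (innerPotential M φ μB I π β θs ρs) ≤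
      innerPotential M φ μB I π β θs ρs s + (gradTheta M φ μB I.c π β θs +
        gradRho φ μB I.c β * ρs + ((2 * I.η * D ^ 2 + I.ξ) * H + I.ξ)) := by
  have hfin := support_innerSample_finite M μB π
  rw [innerStep_eq_map, PMF.expect_map hfin]
  -- The part of the one-step bound that does not depend on the fresh sample.
  set k : ℝ := gradTheta M φ μB I.c π β (s.sumθ + s.θ) +
    gradRho φ μB I.c β * (s.sumρ + s.ρ) + ‖s.θ - θs‖ ^ 2 / (2 * I.η) +
      (s.ρ - ρs) ^ 2 / (2 * I.ξ) + I.ξ - (s.ρ - ρs) with hk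
  have hpt : ∀ y ∈ (innerSample M μB π).support,
      innerPotential M φ μB I π β θs ρs
        { θ := projBall I.Dθ (s.θ - I.η • (impWeight φ μB I.c β (y.1.1, y.1.2.1) • φ y.1.2.2 y.2 -
            impWeight φ μB I.c β (y.1.1, y.1.2.1) • φ y.1.1 y.1.2.1))
          ρ := projUnit (s.ρ - I.ξ * (1 - impWeight φ μB I.c β (y.1.1, y.1.2.1)))
          sumθ := s.sumθ + s.θ
          sumρ := s.sumρ + s.ρ } ≤
      k + ((-1) * (impWeight φ μB I.c β (y.1.1, y.1.2.1) *
        inner ℝ (φ y.1.2.2 y.2 - φ y.1.1 y.1.2.1) (s.θ - θs)) +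
        ((s.ρ - ρs) * impWeight φ μB I.c β (y.1.1, y.1.2.1) +
        (2 * I.η * D ^ 2 + I.ξ) * impWeight φ μB I.c β (y.1.1, y.1.2.1) ^ 2)) := by
    intro y _
    set m := impWeight φ μB I.c β (y.1.1, y.1.2.1)
    set f' := φ y.1.2.2 y.2
    set f := φ y.1.1 y.1.2.1
    have h1 := norm_sq_projBall_sub_le hθs (s.θ - I.η • (m • f' - m • f))
    have h2 := sq_projUnit_sub_le hρs (s.ρ - I.ξ * (1 - m))
    have h3 : ‖s.θ - I.η • (m • f' - m • f) - θs‖ ^ 2 ≤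
        ‖s.θ - θs‖ ^ 2 - 2 * I.η * (m * inner ℝ (f' - f) (s.θ - θs)) +
          I.η ^ 2 * m ^ 2 * (4 * D ^ 2) := by
      have h4 : s.θ - I.η • (m • f' - m • f) - θs = (s.θ - θs) - (I.η * m) • (f' - f) := by
        rw [← smul_sub, smul_smul]; abel
      rw [h4, norm_sub_sq_real, real_inner_smul_right, norm_smul, mul_pow, Real.norm_eq_abs,
        sq_abs, real_inner_comm, mul_pow]
      have h5 := norm_sub_sq_le_of_norm_le (hφ y.1.2.2 y.2) (hφ y.1.1 y.1.2.1)
      have h6 := mul_le_mul_of_nonneg_left h5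
        (mul_nonneg (sq_nonneg I.η) (sq_nonneg m))
      linarith
    have h7 : ‖projBall I.Dθ (s.θ - I.η • (m • f' - m • f)) - θs‖ ^ 2 / (2 * I.η) ≤
        ‖s.θ - θs‖ ^ 2 / (2 * I.η) - m * inner ℝ (f' - f) (s.θ - θs) +
          2 * I.η * D ^ 2 * m ^ 2 := by
      rw [div_le_iff₀ (by positivity)]
      refine (h1.trans h3).trans_eq ?_
      field_simp
      ring
    have h8 : (projUnit (s.ρ - I.ξ * (1 - m)) - ρs) ^ 2 / (2 * I.ξ) ≤
        (s.ρ - ρs) ^ 2 / (2 * I.ξ) - (s.ρ - ρs) * (1 - m) + I.ξ * (1 + m ^ 2) := by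
      rw [div_le_iff₀ (by positivity)]
      refine h2.trans ?_
      have h9 : ((s.ρ - ρs) ^ 2 / (2 * I.ξ) - (s.ρ - ρs) * (1 - m) + I.ξ * (1 + m ^ 2)) *
          (2 * I.ξ) = (s.ρ - ρs) ^ 2 - 2 * I.ξ * (s.ρ - ρs) * (1 - m) +
            I.ξ ^ 2 * (2 + 2 * m ^ 2) := by
        field_simp
      rw [h9]
      nlinarith [mul_nonneg (sq_nonneg I.ξ) (sq_nonneg (1 + m))]
    simp only [innerPotential, hk]
    linarith
  refine (PMF.expect_mono hfin hpt).trans ?_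
  rw [PMF.expect_add hfin, PMF.expect_const, PMF.expect_add hfin, PMF.expect_const_mul,
    PMF.expect_add hfin, PMF.expect_const_mul, PMF.expect_const_mul]
  have e1 := expect_innerSample_of_pair M μB π (impWeight φ μB I.c β)
  have e2 := expect_innerSample_of_pair M μB π (fun z => impWeight φ μB I.c β z ^ 2)
  have e3 : (innerSample M μB π).expect (fun y => impWeight φ μB I.c β (y.1.1, y.1.2.1) *
      inner ℝ (φ y.1.2.2 y.2 - φ y.1.1 y.1.2.1) (s.θ - θs)) =
      gradTheta M φ μB I.c π β s.θ - gradTheta M φ μB I.c π β θs := by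
    rw [← gradTheta_sub]; rfl
  rw [e1, e2, e3]
  have e4 := mul_le_mul_of_nonneg_left hH (by positivity : 0 ≤ 2 * I.η * D ^ 2 + I.ξ)
  simp only [hk, innerPotential, gradTheta_add, gradRho]
  linarith

theorem expect_innerRun_innerPotential_le {M : MDP X A} {φ : X → A → Vec d}
    {μB : stdSimplex ℝ (X × A)} {I : AlgInput d} (π : Policy X A) {β θs : Vec d} {ρs D H : ℝ}
    (hη : 0 < I.η) (hξ : 0 < I.ξ) (hφ : ∀ x a, ‖φ x a‖ ≤ D)
    (hH : ∑ z, μB z * impWeight φ μB I.c β z ^ 2 ≤ H)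
    (hθs : ‖θs‖ ≤ I.Dθ) (hρs : ρs ∈ Set.Icc (0 : ℝ) 1) (θ : Vec d) (ρ : ℝ) (i : ℕ) :
    (innerRun M φ μB I π β θ ρ i).expect (innerPotential M φ μB I π β θs ρs) ≤
      ‖θ - θs‖ ^ 2 / (2 * I.η) + (ρ - ρs) ^ 2 / (2 * I.ξ) + i * (gradTheta M φ μB I.c π β θs +
        gradRho φ μB I.c β * ρs + ((2 * I.η * D ^ 2 + I.ξ) * H + I.ξ)) := by
  induction i with
  | zero =>
    have h0 : gradTheta M φ μB I.c π β 0 = 0 := by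
      simpa using gradTheta_smul M φ μB I.c π β 0 0
    simp [innerRun, PMF.expect_pure, innerPotential, h0]
  | succ i ih =>
    have hfin := support_innerRun_finite M φ μB I π β θ ρ i
    rw [innerRun, PMF.expect_bind hfin (support_innerStep_finite M φ μB I π β)]
    refine (PMF.expect_mono hfin fun s _ =>
      expect_innerStep_innerPotential_le π hη hξ hφ hH hθs hρs s).trans ?_
    rw [PMF.expect_add hfin, PMF.expect_const]
    push_cast
    linarith

theorem innerRun_support_bounds {M : MDP X A} {φ : X → A → Vec d} {μB : stdSimplex ℝ (X × A)}
    {I : AlgInput d} {π : Policy X A} {β θ : Vec d} {ρ : ℝ} (hθ : ‖θ‖ ≤ I.Dθ)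
    (hρ : ρ ∈ Set.Icc (0 : ℝ) 1) (i : ℕ) :
    ∀ s ∈ (innerRun M φ μB I π β θ ρ i).support, ‖s.θ‖ ≤ I.Dθ ∧ s.ρ ∈ Set.Icc (0 : ℝ) 1 ∧
      ‖s.sumθ‖ ≤ i * I.Dθ ∧ s.sumρ ∈ Set.Icc (0 : ℝ) i := by
  induction i with
  | zero =>
    intro s hs
    simp only [innerRun, PMF.support_pure, Set.mem_singleton_iff] at hs
    subst hs
    exact ⟨hθ, hρ, by simp, by simp⟩
  | succ i ih =>
    intro s hs
    rw [innerRun, PMF.mem_support_bind_iff] at hs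
    obtain ⟨u, hu, hs⟩ := hs
    rw [innerStep_eq_map, PMF.mem_support_map_iff] at hs
    obtain ⟨y, -, rfl⟩ := hs
    obtain ⟨h1, h2, h3, h4⟩ := ih u hu
    refine ⟨norm_projBall_le ((norm_nonneg _).trans hθ) _, projUnit_mem _, ?_, ?_, ?_⟩
    · refine (norm_add_le _ _).trans ?_
      push_cast
      linarith
    · exact add_nonneg h4.1 h2.1
    · push_cast
      exact add_le_add h4.2 h2.2

/-- Regret of the averaged inner iterates. -/
theorem expect_innerRun_average_le {M : MDP X A} {φ : X → A → Vec d}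
    {μB : stdSimplex ℝ (X × A)} {I : AlgInput d} (π : Policy X A) {β θs θ : Vec d} {ρs ρ D H : ℝ}
    (hη : 0 < I.η) (hξ : 0 < I.ξ) (hφ : ∀ x a, ‖φ x a‖ ≤ D)
    (hH : ∑ z, μB z * impWeight φ μB I.c β z ^ 2 ≤ H)
    (hθs : ‖θs‖ ≤ I.Dθ) (hρs : ρs ∈ Set.Icc (0 : ℝ) 1) (hθ : ‖θ‖ ≤ I.Dθ)
    (hρ : ρ ∈ Set.Icc (0 : ℝ) 1) :
    (innerRun M φ μB I π β θ ρ I.K).expect (fun u =>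
        gradTheta M φ μB I.c π β ((1 / (I.K : ℝ)) • u.sumθ) +
          gradRho φ μB I.c β * ((1 / (I.K : ℝ)) * u.sumρ)) ≤
      gradTheta M φ μB I.c π β θs + gradRho φ μB I.c β * ρs +
        ((2 * I.η * D ^ 2 + I.ξ) * H + I.ξ) +
          (2 * I.Dθ ^ 2 / I.η + 1 / (2 * I.ξ)) / I.K := by
  have hfin := support_innerRun_finite M φ μB I π β θ ρ I.K
  have hK : (0 : ℝ) < (I.K : ℕ) := by exact_mod_cast I.K.pos
  have hrun := expect_innerRun_innerPotential_le (M := M) π hη hξ hφ hH hθs hρs θ ρ I.K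
  have h1 : (innerRun M φ μB I π β θ ρ I.K).expect (fun u =>
        gradTheta M φ μB I.c π β ((1 / (I.K : ℝ)) • u.sumθ) +
          gradRho φ μB I.c β * ((1 / (I.K : ℝ)) * u.sumρ)) ≤
      (1 / (I.K : ℝ)) * (innerRun M φ μB I π β θ ρ I.K).expect
        (innerPotential M φ μB I π β θs ρs) := by
    rw [← PMF.expect_const_mul]
    refine PMF.expect_mono hfin fun u _ => ?_
    -- The final distances are nonnegative and are dropped; the slopes are linear, so they pass to
    -- the average.
    have h2 : 0 ≤ (1 / (I.K : ℝ)) * (‖u.θ - θs‖ ^ 2 / (2 * I.η) + (u.ρ - ρs) ^ 2 / (2 * I.ξ)) := by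
      positivity
    rw [gradTheta_smul, innerPotential]
    linarith
  have h3 : ‖θ - θs‖ ^ 2 / (2 * I.η) ≤ 2 * I.Dθ ^ 2 / I.η := by
    rw [div_le_div_iff₀ (by positivity) hη]
    nlinarith [norm_sub_sq_le_of_norm_le hθ hθs]
  have h4 : (ρ - ρs) ^ 2 / (2 * I.ξ) ≤ 1 / (2 * I.ξ) := by
    gcongr
    nlinarith [hρ.1, hρ.2, hρs.1, hρs.2]
  refine h1.trans ((mul_le_mul_of_nonneg_left hrun (by positivity)).trans ?_)
  have h5 := mul_le_mul_of_nonneg_left (add_le_add h3 h4) (one_div_nonneg.2 hK.le)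
  have h6 : (1 / (I.K : ℝ)) * ((I.K : ℕ) * (gradTheta M φ μB I.c π β θs +
        gradRho φ μB I.c β * ρs + ((2 * I.η * D ^ 2 + I.ξ) * H + I.ξ))) =
      gradTheta M φ μB I.c π β θs +
        gradRho φ μB I.c β * ρs + ((2 * I.η * D ^ 2 + I.ξ) * H + I.ξ) := by
    field_simp
  rw [mul_add, h6, div_eq_mul_one_div (2 * I.Dθ ^ 2 / I.η + 1 / (2 * I.ξ)) (I.K : ℝ)]
  linarith

end InnerLoop

/-! ### Linear action values, stationarity and gains. -/

section ActionValues

variable {X A : Type*} [Fintype X] {d : ℕ}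

namespace MDP

/-- Normalization of p makes constants linear in φ. This lets ρ enter the linear form of the error,
bounds the coverage ratio below and forces d ≥ 1. -/
theorem IsLinear.inner_sum_psi {M : MDP X A} {φ : X → A → Vec d} {ψ : X → Vec d} {ω : Vec d}
    {Dφ Dψ Dω : ℝ} (h : M.IsLinear φ ψ ω Dφ Dψ Dω) (x : X) (a : A) :
    inner ℝ (φ x a) (∑ x', ψ x') = 1 := by
  rw [inner_sum]
  simp only [← h.trans]
  exact stdSimplex_sum _

theorem IsLinear.inner_sum_smul_psi {M : MDP X A} {φ : X → A → Vec d} {ψ : X → Vec d} {ω : Vec d}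
    {Dφ Dψ Dω : ℝ} (h : M.IsLinear φ ψ ω Dφ Dψ Dω) (v : X → ℝ) (x : X) (a : A) :
    inner ℝ (φ x a) (∑ x', v x' • ψ x') = ∑ x', M.p x a x' * v x' := by
  rw [inner_sum]
  refine Finset.sum_congr rfl fun x' _ => ?_
  rw [real_inner_smul_right, h.trans, mul_comm]

variable [Fintype A]

/-- Action-value functions of bounded span are linear in the features, with a parameter of
controlled norm. -/
theorem IsLinear.exists_bellman_param {M : MDP X A} {φ : X → A → Vec d} {ψ : X → Vec d} {ω : Vec d}
    {Dφ Dψ Dω B Dq ρ : ℝ} (h : M.IsLinear φ ψ ω Dφ Dψ Dω)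
    (hψ : ∀ v : X → ℝ, (∀ x, |v x| ≤ 1) → ‖∑ x, v x • ψ x‖ ≤ B) (hDq : 0 < Dq)
    {π : Policy X A} {q : X → A → ℝ} (hq : M.IsBellman π ρ q)
    (hspan : ∀ x a x' a', q x a - q x' a' < Dq) :
    ∃ θ : Vec d, M.IsBellman π ρ (fun x a => inner ℝ (φ x a) θ) ∧ ‖θ‖ ≤ Dω + B * Dq := by
  have hB : 0 ≤ B := by simpa using hψ (fun _ => 0) (by simp)
  have hω : 0 ≤ Dω := (norm_nonneg _).trans h.norm_omega
  rcases isEmpty_or_nonempty X with hX | ⟨⟨x₀⟩⟩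
  · exact ⟨0, fun x => hX.elim x, by simpa using by positivity⟩
  set v : X → ℝ := fun x => ∑ a, π x a * q x a with hv
  have hvd : ∀ x, |v x - v x₀| ≤ Dq := fun x => by
    have key : ∀ x y, v x - v y ≤ Dq := fun x y => by
      have h1 : v x ≤ Dq + v y := by
        refine stdSimplex_sum_mul_le _ fun a => ?_
        have h2 : q x a - Dq ≤ v y := le_stdSimplex_sum_mul _ fun b => by
          linarith [hspan x a y b]
        linarith
      linarith
    exact abs_le.2 ⟨by linarith [key x₀ x], key x x₀⟩
  -- Bellman solutions may be shifted by constants. Centering v at x₀ leaves coefficients bounded by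
  -- the span of q instead of its size.
  have hin : ∀ x a, inner ℝ (φ x a) (ω + ∑ x', (v x' - v x₀) • ψ x') = q x a + (ρ - v x₀) :=
    fun x a => by
      rw [inner_add_right, h.inner_sum_smul_psi, ← h.reward, hq x a]
      simp only [mul_sub, Finset.sum_sub_distrib, stdSimplex_sum_mul_const]
      ring
  refine ⟨ω + ∑ x', (v x' - v x₀) • ψ x', fun x a => ?_, ?_⟩
  · simp only [hin, mul_add, Finset.sum_add_distrib, stdSimplex_sum_mul_const]
    rw [hq x a]
    ring
  · have h1 : ∑ x', (v x' - v x₀) • ψ x' = Dq • ∑ x', ((v x' - v x₀) / Dq) • ψ x' := by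
      rw [Finset.smul_sum]
      refine Finset.sum_congr rfl fun x' _ => ?_
      rw [smul_smul, mul_div_cancel₀ _ hDq.ne']
    have h2 := hψ (fun x' => (v x' - v x₀) / Dq) fun x' => by
      rw [abs_div, abs_of_pos hDq, div_le_one hDq]
      exact hvd x'
    refine (norm_add_le _ _).trans (add_le_add h.norm_omega ?_)
    rw [h1, norm_smul, Real.norm_of_nonneg hDq.le, mul_comm]
    exact mul_le_mul_of_nonneg_right h2 hDq.le

theorem sum_mul_of_eq_mul {π : Policy X A} {μ : stdSimplex ℝ (X × A)}
    {ν : stdSimplex ℝ X} (hμ : ∀ x a, μ (x, a) = π x a * ν x) (f : X → A → ℝ) :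
    ∑ z : X × A, μ z * f z.1 z.2 = ∑ x, ν x * ∑ a, π x a * f x a := by
  rw [Fintype.sum_prod_type]
  refine Finset.sum_congr rfl fun x _ => ?_
  rw [Finset.mul_sum]
  exact Finset.sum_congr rfl fun a _ => by rw [hμ]; ring

theorem IsOccupancy.sum_trans {M : MDP X A} {μ : stdSimplex ℝ (X × A)}
    {ν : stdSimplex ℝ X} (hν : ∀ x', ν x' = ∑ x, ∑ a, μ (x, a) * M.p x a x') (v : X → ℝ) :
    ∑ z : X × A, μ z * ∑ x', M.p z.1 z.2 x' * v x' = ∑ x, ν x * v x := by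
  simp only [Finset.mul_sum]
  rw [Finset.sum_comm]
  refine Finset.sum_congr rfl fun x' _ => ?_
  rw [hν x', ← Fintype.sum_prod_type' (f := fun x a => μ (x, a) * M.p x a x'), Finset.sum_mul]
  exact Finset.sum_congr rfl fun z _ => by ring

/-- The mean reward under an occupancy measure is the gain of the Bellman equations. -/
theorem IsOccupancy.sum_reward {M : MDP X A} {π : Policy X A} {μ : stdSimplex ℝ (X × A)}
    (hμ : M.IsOccupancy π μ) {ρ : ℝ} {q : X → A → ℝ} (hq : M.IsBellman π ρ q) :
    ∑ z : X × A, μ z * M.r z.1 z.2 = ρ := by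
  obtain ⟨ν, h1, h2⟩ := hμ
  have h3 : ∑ z : X × A, μ z * q z.1 z.2 = ∑ z : X × A, μ z * (M.r z.1 z.2 - ρ +
      ∑ x', M.p z.1 z.2 x' * ∑ a', π x' a' * q x' a') :=
    Finset.sum_congr rfl fun z _ => by rw [hq z.1 z.2]
  simp only [mul_add, mul_sub, Finset.sum_add_distrib, Finset.sum_sub_distrib,
    stdSimplex_sum_mul_const] at h3
  rw [IsOccupancy.sum_trans h2 fun x' => ∑ a', π x' a' * q x' a',
    sum_mul_of_eq_mul h1] at h3
  linarith

end MDP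

end ActionValues

/-! ### The Lagrangian, its two explicit values, and the ascent in β. -/

section Lagrangian

variable {X A : Type*} [Fintype X] [Fintype A] {d : ℕ}

/-- Value of the state `x` under `π` for the linear action values `⟨φ, θ⟩`. -/
noncomputable def stateValue (φ : X → A → Vec d) (π : Policy X A) (θ : Vec d) (x : X) : ℝ :=
  ∑ b, π x b * inner ℝ (φ x b) θ

/-- Temporal difference error at the transition `w = (x, a, x')`. -/
noncomputable def tdError (M : MDP X A) (φ : X → A → Vec d) (π : Policy X A) (θ : Vec d) (ρ : ℝ)
    (w : X × A × X) : ℝ :=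
  M.r w.1 w.2.1 + stateValue φ π θ w.2.2 - inner ℝ θ (φ w.1 w.2.1) - ρ

/-- Mean of the temporal difference error weighted by the importance weights of `u`. -/
noncomputable def weightedTD (M : MDP X A) (φ : X → A → Vec d) (μB : stdSimplex ℝ (X × A)) (c : ℝ)
    (π : Policy X A) (θ : Vec d) (ρ : ℝ) (u : Vec d) : ℝ :=
  (sampleLaw M μB).expect fun w => tdError M φ π θ ρ w * impWeight φ μB c u (w.1, w.2.1)

theorem weightedTD_eq (M : MDP X A) (φ : X → A → Vec d) (μB : stdSimplex ℝ (X × A)) (c : ℝ)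
    (π : Policy X A) (θ : Vec d) (ρ : ℝ) (u : Vec d) :
    weightedTD M φ μB c π θ ρ u = ∑ z, μB z * (impWeight φ μB c u z * (M.r z.1 z.2 +
      ∑ x', M.p z.1 z.2 x' * stateValue φ π θ x' - inner ℝ (φ z.1 z.2) θ - ρ)) := by
  rw [weightedTD, expect_sampleLaw]
  refine Finset.sum_congr rfl fun z _ => ?_
  simp only [tdError, ← mul_assoc]
  rw [← Finset.sum_mul]
  simp only [mul_add, mul_sub, Finset.sum_add_distrib, Finset.sum_sub_distrib,
    stdSimplex_sum_mul_const, real_inner_comm (φ z.1 z.2) θ]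
  ring

theorem gradTheta_eq (M : MDP X A) (φ : X → A → Vec d) (μB : stdSimplex ℝ (X × A)) (c : ℝ)
    (π : Policy X A) (β u : Vec d) :
    gradTheta M φ μB c π β u = ∑ z, μB z * (impWeight φ μB c β z *
      (∑ x', M.p z.1 z.2 x' * stateValue φ π u x' - inner ℝ (φ z.1 z.2) u)) := by
  rw [gradTheta, expect_innerSample]
  refine Finset.sum_congr rfl fun z _ => ?_
  simp only [mul_left_comm _ (impWeight φ μB c β z), ← Finset.mul_sum]
  simp only [inner_sub_left, mul_sub, Finset.sum_sub_distrib, stdSimplex_sum_mul_const]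
  rfl

/-- The Lagrangian is affine in (θ, ρ), and the subtracted reward term is its constant part. So the
regret of the inner loop is a difference of Lagrangian values. -/
theorem gradTheta_add_gradRho_mul (M : MDP X A) (φ : X → A → Vec d) (μB : stdSimplex ℝ (X × A))
    (c : ℝ) (π : Policy X A) (β θ : Vec d) (ρ : ℝ) :
    gradTheta M φ μB c π β θ + gradRho φ μB c β * ρ = weightedTD M φ μB c π θ ρ β -
      ∑ z, μB z * (impWeight φ μB c β z * M.r z.1 z.2) + ρ := by
  rw [gradTheta_eq, weightedTD_eq, gradRho, sub_mul, Finset.sum_mul, one_mul,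
    ← Finset.sum_sub_distrib, ← add_sub_assoc, add_sub_right_comm, ← Finset.sum_sub_distrib]
  congr 1
  exact Finset.sum_congr rfl fun z _ => by ring

theorem weightedTD_eq_zero {M : MDP X A} {φ : X → A → Vec d} {π : Policy X A} {θ : Vec d} {ρ : ℝ}
    (h : M.IsBellman π ρ fun x a => inner ℝ (φ x a) θ) (μB : stdSimplex ℝ (X × A)) (c : ℝ)
    (u : Vec d) : weightedTD M φ μB c π θ ρ u = 0 := by
  rw [weightedTD_eq]
  refine Finset.sum_eq_zero fun z _ => ?_
  have h1 := h z.1 z.2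
  simp only at h1
  have h2 : M.r z.1 z.2 + ∑ x', M.p z.1 z.2 x' * stateValue φ π θ x' - inner ℝ (φ z.1 z.2) θ - ρ
      = 0 := by
    simp only [stateValue]
    linarith
  rw [h2]
  simp

/-- The conditional mean error is ⟨φ, u⟩ for one vector u, so the weights of `βs` replace the data
law by `μs`. Stationarity then turns the next-state value into a ν-average. -/
theorem weightedTD_comparator {M : MDP X A} {φ : X → A → Vec d} {ψ : X → Vec d} {ω : Vec d}
    {Dφ Dψ Dω c : ℝ} (h : M.IsLinear φ ψ ω Dφ Dψ Dω) {μB μs : stdSimplex ℝ (X × A)} {βs : Vec d}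
    (hβs : ∀ u : Vec d, ∑ z : X × A, μB z * (inner ℝ (φ z.1 z.2) (scaled φ μB c βs) *
        inner ℝ (φ z.1 z.2) u) = ∑ z : X × A, μs z * inner ℝ (φ z.1 z.2) u)
    {πs : Policy X A} {ν : stdSimplex ℝ X} (hμs : ∀ x a, μs (x, a) = πs x a * ν x)
    (hν : ∀ x', ν x' = ∑ x, ∑ a, μs (x, a) * M.p x a x')
    (π : Policy X A) (θ : Vec d) (ρ : ℝ) :
    weightedTD M φ μB c π θ ρ βs = ∑ z : X × A, μs z * M.r z.1 z.2 +
      ∑ x, ν x * stateValue φ π θ x - ∑ x, ν x * stateValue φ πs θ x - ρ := by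
  have h1 : ∀ z : X × A, M.r z.1 z.2 + ∑ x', M.p z.1 z.2 x' * stateValue φ π θ x' -
      inner ℝ (φ z.1 z.2) θ - ρ = inner ℝ (φ z.1 z.2)
        (ω + ∑ x', stateValue φ π θ x' • ψ x' - θ - ρ • ∑ x', ψ x') := fun z => by
    rw [inner_sub_right, inner_sub_right, inner_add_right, h.inner_sum_smul_psi,
      real_inner_smul_right, h.inner_sum_psi, ← h.reward]
    ring
  rw [weightedTD_eq]
  simp only [h1, impWeight]
  rw [hβs]
  simp only [← h1]
  simp only [mul_add, mul_sub, Finset.sum_add_distrib, Finset.sum_sub_distrib,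
    stdSimplex_sum_mul_const]
  rw [MDP.IsOccupancy.sum_trans hν,
    MDP.sum_mul_of_eq_mul hμs fun x a => inner ℝ (φ x a) θ]
  rfl

theorem abs_inner_le_of_norm_le {u v : Vec d} {D E : ℝ} (hu : ‖u‖ ≤ D) (hv : ‖v‖ ≤ E) :
    |inner ℝ u v| ≤ D * E :=
  (abs_real_inner_le_norm u v).trans
    (mul_le_mul hu hv (norm_nonneg v) ((norm_nonneg u).trans hu))

theorem abs_tdError_le {M : MDP X A} {φ : X → A → Vec d} {D E : ℝ} (hφ : ∀ x a, ‖φ x a‖ ≤ D)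
    (π : Policy X A) {θ : Vec d} (hθ : ‖θ‖ ≤ E) {ρ : ℝ} (hρ : ρ ∈ Set.Icc (0 : ℝ) 1)
    (w : X × A × X) : |tdError M φ π θ ρ w| ≤ 1 + 2 * D * E := by
  have h1 : |stateValue φ π θ w.2.2| ≤ D * E :=
    abs_stdSimplex_sum_mul_le _ fun b => abs_inner_le_of_norm_le (hφ _ _) hθ
  have h2 := abs_inner_le_of_norm_le (hφ w.1 w.2.1) hθ
  rw [real_inner_comm] at h2
  have h3 := M.r_mem w.1 w.2.1
  have h4 := abs_le.1 h1
  have h5 := abs_le.1 h2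
  rw [tdError, abs_le]
  constructor <;> linarith [h3.1, h3.2, hρ.1, hρ.2, h4.1, h4.2, h5.1, h5.2]

/-- One projected stochastic gradient ascent step on `β`. -/
theorem expect_betaStep_le {M : MDP X A} {φ : X → A → Vec d} {μB : stdSimplex ℝ (X × A)}
    {c ζ D E Dβ G : ℝ} (hζ : 0 < ζ) (hφ : ∀ x a, ‖φ x a‖ ≤ D)
    (hG : ∑ z : X × A, μB z * ‖scaled φ μB c (φ z.1 z.2)‖ ^ 2 ≤ G)
    (π : Policy X A) {θ : Vec d} (hθ : ‖θ‖ ≤ E) {ρ : ℝ} (hρ : ρ ∈ Set.Icc (0 : ℝ) 1)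
    {βs : Vec d} (hβs : ‖βs‖ ≤ Dβ) (β : Vec d) :
    (sampleLaw M μB).expect (fun w => ‖projBall Dβ (β + ζ • (tdError M φ π θ ρ w •
        scaled φ μB c (φ w.1 w.2.1))) - βs‖ ^ 2 / (2 * ζ)) ≤
      ‖β - βs‖ ^ 2 / (2 * ζ) + (weightedTD M φ μB c π θ ρ β - weightedTD M φ μB c π θ ρ βs) +
        ζ / 2 * (1 + 2 * D * E) ^ 2 * G := by
  have hfin := support_sampleLaw_finite M μB
  have hpt : ∀ w ∈ (sampleLaw M μB).support,
      ‖projBall Dβ (β + ζ • (tdError M φ π θ ρ w • scaled φ μB c (φ w.1 w.2.1))) - βs‖ ^ 2 /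
        (2 * ζ) ≤ ‖β - βs‖ ^ 2 / (2 * ζ) + (tdError M φ π θ ρ w *
          impWeight φ μB c β (w.1, w.2.1) + ((-1) * (tdError M φ π θ ρ w *
          impWeight φ μB c βs (w.1, w.2.1)) + (ζ / 2 * (1 + 2 * D * E) ^ 2) *
          ‖scaled φ μB c (φ w.1 w.2.1)‖ ^ 2)) := by
    intro w _
    have h1 := norm_sq_projBall_sub_le hβs
      (β + ζ • (tdError M φ π θ ρ w • scaled φ μB c (φ w.1 w.2.1)))
    have htd := abs_tdError_le (M := M) hφ π hθ hρ w
    have htd2 : tdError M φ π θ ρ w ^ 2 ≤ (1 + 2 * D * E) ^ 2 := by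
      rw [← sq_abs]
      exact pow_le_pow_left₀ (abs_nonneg _) htd 2
    -- Symmetry of Λ^{c-1} identifies the cross term of the expanded square with a difference of
    -- importance weights.
    have h2 : impWeight φ μB c β (w.1, w.2.1) - impWeight φ μB c βs (w.1, w.2.1) =
        inner ℝ (β - βs) (scaled φ μB c (φ w.1 w.2.1)) := by
      rw [← scaled_comm, real_inner_comm]
      simp only [impWeight, scaled, map_sub, inner_sub_right]
    set g := scaled φ μB c (φ w.1 w.2.1)
    set δ := tdError M φ π θ ρ w
    have h3 : β + ζ • (δ • g) - βs = (β - βs) + (ζ * δ) • g := by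
      rw [smul_smul]; abel
    rw [h3, norm_add_sq_real, real_inner_smul_right, norm_smul, mul_pow, Real.norm_eq_abs,
      sq_abs, ← h2] at h1
    have h4 := mul_le_mul_of_nonneg_right htd2 (sq_nonneg ‖g‖)
    rw [div_le_iff₀ (by positivity)]
    refine h1.trans ?_
    have h5 : ‖β - βs‖ ^ 2 / (2 * ζ) * (2 * ζ) = ‖β - βs‖ ^ 2 :=
      div_mul_cancel₀ _ (by positivity)
    rw [add_mul, h5]
    nlinarith [mul_le_mul_of_nonneg_left h4 (sq_nonneg ζ)]
  refine (PMF.expect_mono hfin hpt).trans ?_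
  rw [PMF.expect_add hfin, PMF.expect_const, PMF.expect_add hfin, PMF.expect_add hfin,
    PMF.expect_const_mul, PMF.expect_const_mul]
  have e1 : (sampleLaw M μB).expect (fun w => ‖scaled φ μB c (φ w.1 w.2.1)‖ ^ 2) ≤ G := by
    rw [expect_sampleLaw]
    simp only [stdSimplex_sum_mul_const]
    exact hG
  have e2 := mul_le_mul_of_nonneg_left e1
    (by positivity : 0 ≤ ζ / 2 * (1 + 2 * D * E) ^ 2)
  simp only [weightedTD]
  linarith

end Lagrangian

/-! ### Log-partition estimates for exponential weights. -/

section Softmax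

variable {X A : Type*} [Fintype A] {d : ℕ}

/-- Logarithm of the normalizing constant of the softmax policy at the state `x`. -/
noncomputable def logPartition (φ : X → A → Vec d) (α : ℝ) (u : Vec d) (x : X) : ℝ :=
  Real.log (∑ b, Real.exp (α * inner ℝ (φ x b) u))

theorem logPartition_zero (φ : X → A → Vec d) (α : ℝ) (x : X) :
    logPartition φ α 0 x = Real.log (Fintype.card A) := by
  simp [logPartition]

variable [Nonempty A]

theorem sum_exp_pos (f : A → ℝ) : 0 < ∑ b, Real.exp (f b) :=
  Finset.sum_pos (fun _ _ => Real.exp_pos _) Finset.univ_nonempty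

/-- Log-sum-exp dominates each exponent, hence each average of them. This makes the policy potential
nonnegative for every comparator. -/
theorem mul_stateValue_le_logPartition (φ : X → A → Vec d) (α : ℝ) (u : Vec d) (π : Policy X A)
    (x : X) : α * stateValue φ π u x ≤ logPartition φ α u x := by
  rw [stateValue, Finset.mul_sum]
  simp only [mul_left_comm α]
  refine stdSimplex_sum_mul_le _ fun a => ?_
  rw [logPartition, Real.le_log_iff_exp_le (sum_exp_pos _)]
  exact Finset.single_le_sum (f := fun b => Real.exp (α * inner ℝ (φ x b) u))
    (fun _ _ => (Real.exp_pos _).le) (Finset.mem_univ a)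

/-- The increment is the log of the mean of e^{α⟨φ,θ⟩} under the current softmax. Apply e^y ≤ 1 + y
+ y² for |y| ≤ 1, then 1 + y ≤ e^y. -/
theorem logPartition_add_le {φ : X → A → Vec d} {α D E : ℝ} (hα : 0 ≤ α)
    (hφ : ∀ x a, ‖φ x a‖ ≤ D) (hDE : α * (D * E) ≤ 1) {θ : Vec d} (hθ : ‖θ‖ ≤ E) (u : Vec d)
    (x : X) :
    logPartition φ α (u + θ) x ≤ logPartition φ α u x +
      α * stateValue φ (softmaxPolicy φ α u) θ x + (α * (D * E)) ^ 2 := by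
  set Z := ∑ b, Real.exp (α * inner ℝ (φ x b) u) with hZ
  have hZpos : 0 < Z := sum_exp_pos _
  have hπ : ∀ b, (softmaxPolicy φ α u x) b = Real.exp (α * inner ℝ (φ x b) u) / Z := fun b => rfl
  have h1 : ∑ b, Real.exp (α * inner ℝ (φ x b) (u + θ)) =
      Z * ∑ b, softmaxPolicy φ α u x b * Real.exp (α * inner ℝ (φ x b) θ) := by
    rw [Finset.mul_sum]
    refine Finset.sum_congr rfl fun b _ => ?_
    rw [hπ, inner_add_right, mul_add, Real.exp_add]
    field_simp
  have h2 : ∑ b, softmaxPolicy φ α u x b * Real.exp (α * inner ℝ (φ x b) θ) ≤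
      Real.exp (α * stateValue φ (softmaxPolicy φ α u) θ x + (α * (D * E)) ^ 2) := by
    have h3 : ∀ b, Real.exp (α * inner ℝ (φ x b) θ) ≤
        1 + α * inner ℝ (φ x b) θ + (α * (D * E)) ^ 2 := fun b => by
      have h4 : |α * inner ℝ (φ x b) θ| ≤ α * (D * E) := by
        rw [abs_mul, abs_of_nonneg hα]
        exact mul_le_mul_of_nonneg_left (abs_inner_le_of_norm_le (hφ x b) hθ) hα
      have h5 := (abs_le.1 (Real.abs_exp_sub_one_sub_id_le (h4.trans hDE))).2
      have h6 := pow_le_pow_left₀ (abs_nonneg _) h4 2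
      rw [sq_abs] at h6
      linarith
    refine (Finset.sum_le_sum fun b _ => mul_le_mul_of_nonneg_left (h3 b)
      (stdSimplex_nonneg _ b)).trans ?_
    simp only [mul_add, Finset.sum_add_distrib, stdSimplex_sum_mul_const]
    have h7 : ∑ b, softmaxPolicy φ α u x b * (α * inner ℝ (φ x b) θ) =
        α * stateValue φ (softmaxPolicy φ α u) θ x := by
      rw [stateValue, Finset.mul_sum]
      exact Finset.sum_congr rfl fun b _ => by ring
    rw [h7]
    refine le_trans ?_ (Real.add_one_le_exp _)
    linarith
  have h8 : 0 < ∑ b, Real.exp (α * inner ℝ (φ x b) (u + θ)) := sum_exp_pos _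
  rw [logPartition, Real.log_le_iff_le_exp h8, add_assoc, Real.exp_add, logPartition,
    Real.exp_log hZpos, h1]
  exact mul_le_mul_of_nonneg_left h2 hZpos.le

end Softmax

/-! ### Combining the three regrets over the outer loop. -/

section OuterLoop

variable {X A : Type*} [Fintype A] {d : ℕ}

theorem stateValue_add (φ : X → A → Vec d) (π : Policy X A) (u v : Vec d) (x : X) :
    stateValue φ π (u + v) x = stateValue φ π u x + stateValue φ π v x := by
  simp only [stateValue, inner_add_right, mul_add, Finset.sum_add_distrib]

variable [Fintype X]

/-- Potential of the policy player. -/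
noncomputable def policyPotential (φ : X → A → Vec d) (α : ℝ) (πs : Policy X A)
    (ν : stdSimplex ℝ X) (u : Vec d) : ℝ :=
  ∑ x, ν x * (logPartition φ α u x / α - stateValue φ πs u x)

theorem policyPotential_zero (φ : X → A → Vec d) (α : ℝ) (πs : Policy X A)
    (ν : stdSimplex ℝ X) : policyPotential φ α πs ν 0 = Real.log (Fintype.card A) / α := by
  simp only [policyPotential, logPartition_zero, stateValue, inner_zero_right, mul_zero,
    Finset.sum_const_zero, sub_zero, stdSimplex_sum_mul_const]

theorem innerRun_average_bounds {M : MDP X A} {φ : X → A → Vec d} {μB : stdSimplex ℝ (X × A)}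
    {I : AlgInput d} {π : Policy X A} {β θ : Vec d} {ρ : ℝ} (hθ : ‖θ‖ ≤ I.Dθ)
    (hρ : ρ ∈ Set.Icc (0 : ℝ) 1) {u : InnerState d}
    (hu : u ∈ (innerRun M φ μB I π β θ ρ I.K).support) :
    ‖(1 / (I.K : ℝ)) • u.sumθ‖ ≤ I.Dθ ∧ (1 / (I.K : ℝ)) * u.sumρ ∈ Set.Icc (0 : ℝ) 1 := by
  have hK : (0 : ℝ) < (I.K : ℕ) := by exact_mod_cast I.K.pos
  obtain ⟨-, -, h1, h2⟩ := innerRun_support_bounds hθ hρ I.K u hu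
  refine ⟨?_, mul_nonneg (by positivity) h2.1, ?_⟩
  · rw [norm_smul, Real.norm_of_nonneg (by positivity), one_div, inv_mul_le_iff₀ hK]
    exact h1
  · rw [one_div, inv_mul_le_iff₀ hK, mul_one]
    exact h2.2

/-- Standing assumptions of the regret analysis: a comparator `(βs, πs)` with mean reward `R` and
state distribution `ν`, the gains `ρ π` of all policies, a bound `D` on the features, and bounds
`H`, `G` on the second moments of the importance weights and of the rescaled features. -/
structure RegretSetup (M : MDP X A) (φ : X → A → Vec d) (μB : stdSimplex ℝ (X × A))
    (I : AlgInput d) (ρ : Policy X A → ℝ) (πs : Policy X A) (ν : stdSimplex ℝ X) (βs : Vec d)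
    (R D H G : ℝ) : Prop where
  η_pos : 0 < I.η
  ξ_pos : 0 < I.ξ
  ζ_pos : 0 < I.ζ
  α_pos : 0 < I.α
  α_mul_le : I.α * (D * I.Dθ) ≤ 1
  norm_feat : ∀ x a, ‖φ x a‖ ≤ D
  sq_impWeight : ∀ β : Vec d, ‖β‖ ≤ I.Dβ → ∑ z, μB z * impWeight φ μB I.c β z ^ 2 ≤ H
  sq_scaled : ∑ z : X × A, μB z * ‖scaled φ μB I.c (φ z.1 z.2)‖ ^ 2 ≤ G
  norm_comparator : ‖βs‖ ≤ I.Dβ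
  comparator : ∀ (π : Policy X A) (θ : Vec d) (ρ' : ℝ), weightedTD M φ μB I.c π θ ρ' βs =
    R + ∑ x, ν x * stateValue φ π θ x - ∑ x, ν x * stateValue φ πs θ x - ρ'
  gain_mem : ∀ π, ρ π ∈ Set.Icc (0 : ℝ) 1
  bellman : ∀ π, ∃ θ : Vec d, M.IsBellman π (ρ π) (fun x a => inner ℝ (φ x a) θ) ∧ ‖θ‖ ≤ I.Dθ
  norm_β₁ : ‖I.β₁‖ ≤ I.Dβ
  norm_θ₀ : ‖I.θ₀‖ ≤ I.Dθ
  ρ₀_mem : I.ρ₀ ∈ Set.Icc (0 : ℝ) 1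

variable [Nonempty A]

theorem policyPotential_nonneg (φ : X → A → Vec d) {α : ℝ} (hα : 0 < α) (πs : Policy X A)
    (ν : stdSimplex ℝ X) (u : Vec d) : 0 ≤ policyPotential φ α πs ν u := by
  refine Finset.sum_nonneg fun x _ => mul_nonneg (stdSimplex_nonneg ν x) (sub_nonneg.2 ?_)
  rw [le_div_iff₀ hα, mul_comm]
  exact mul_stateValue_le_logPartition φ α u πs x

/-- Exponential weights run in every state at once; ν averages the statewise bounds, divided by α.
-/
theorem policyPotential_add_le {φ : X → A → Vec d} {α D E : ℝ} (hα : 0 < α)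
    (hφ : ∀ x a, ‖φ x a‖ ≤ D) (hDE : α * (D * E) ≤ 1) (πs : Policy X A) (ν : stdSimplex ℝ X)
    {θ : Vec d} (hθ : ‖θ‖ ≤ E) (u : Vec d) :
    policyPotential φ α πs ν (u + θ) ≤ policyPotential φ α πs ν u +
      (∑ x, ν x * stateValue φ (softmaxPolicy φ α u) θ x - ∑ x, ν x * stateValue φ πs θ x) +
        α * (D * E) ^ 2 := by
  have h : ∀ x, logPartition φ α (u + θ) x / α - stateValue φ πs (u + θ) x ≤
      (logPartition φ α u x / α - stateValue φ πs u x) +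
        (stateValue φ (softmaxPolicy φ α u) θ x - stateValue φ πs θ x) + α * (D * E) ^ 2 := by
    intro x
    have h1 := logPartition_add_le hα.le hφ hDE hθ u x
    have h2 : logPartition φ α (u + θ) x / α ≤ logPartition φ α u x / α +
        stateValue φ (softmaxPolicy φ α u) θ x + α * (D * E) ^ 2 := by
      rw [div_le_iff₀ hα]
      refine h1.trans_eq ?_
      field_simp
    rw [stateValue_add]
    linarith
  refine (Finset.sum_le_sum fun x _ => mul_le_mul_of_nonneg_left (h x)
    (stdSimplex_nonneg ν x)).trans_eq ?_
  simp only [policyPotential, mul_add, mul_sub, Finset.sum_add_distrib, Finset.sum_sub_distrib,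
    stdSimplex_sum_mul_const]

/-- Potential of the outer loop: accumulated suboptimality plus the potentials of the two
ascending players. -/
noncomputable def outerPotential (φ : X → A → Vec d) (I : AlgInput d) (ρ : Policy X A → ℝ)
    (πs : Policy X A) (ν : stdSimplex ℝ X) (βs : Vec d) (R : ℝ) (s : OuterState d) : ℝ :=
  ∑ j ∈ Finset.range s.hist.length, (R - ρ (policyOf φ I.α (s.hist.take j))) +
    ‖s.β - βs‖ ^ 2 / (2 * I.ζ) + policyPotential φ I.α πs ν s.hist.sum

theorem outerStep_eq (M : MDP X A) (φ : X → A → Vec d) (μB : stdSimplex ℝ (X × A))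
    (I : AlgInput d) (s : OuterState d) :
    outerStep M φ μB I s =
      (innerRun M φ μB I (policyOf φ I.α s.hist) s.β s.θ s.ρ I.K).bind fun u =>
        (sampleLaw M μB).map fun w =>
          { β := projBall I.Dβ (s.β + I.ζ • (tdError M φ (policyOf φ I.α s.hist)
              ((1 / (I.K : ℝ)) • u.sumθ) ((1 / (I.K : ℝ)) * u.sumρ) w •
                scaled φ μB I.c (φ w.1 w.2.1)))
            θ := (1 / (I.K : ℝ)) • u.sumθ
            ρ := (1 / (I.K : ℝ)) * u.sumρ
            hist := s.hist ++ [(1 / (I.K : ℝ)) • u.sumθ] } := rfl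

theorem support_outerStep_finite (M : MDP X A) (φ : X → A → Vec d) (μB : stdSimplex ℝ (X × A))
    (I : AlgInput d) (s : OuterState d) : (outerStep M φ μB I s).support.Finite := by
  rw [outerStep_eq]
  exact PMF.support_bind_finite (support_innerRun_finite ..) fun u =>
    PMF.support_map_finite (support_sampleLaw_finite M μB) _

theorem support_outerRun_finite (M : MDP X A) (φ : X → A → Vec d) (μB : stdSimplex ℝ (X × A))
    (I : AlgInput d) (t : ℕ) : (outerRun M φ μB I t).support.Finite := by
  induction t with
  | zero => exact PMF.support_pure_finite _
  | succ t ih => exact PMF.support_bind_finite ih (support_outerStep_finite M φ μB I)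

theorem outerRun_support_bounds {M : MDP X A} {φ : X → A → Vec d} {μB : stdSimplex ℝ (X × A)}
    {I : AlgInput d} (hβ : ‖I.β₁‖ ≤ I.Dβ) (hθ : ‖I.θ₀‖ ≤ I.Dθ) (hρ : I.ρ₀ ∈ Set.Icc (0 : ℝ) 1)
    (t : ℕ) : ∀ s ∈ (outerRun M φ μB I t).support, ‖s.β‖ ≤ I.Dβ ∧ ‖s.θ‖ ≤ I.Dθ ∧
      s.ρ ∈ Set.Icc (0 : ℝ) 1 ∧ s.hist.length = t := by
  induction t with
  | zero =>
    intro s hs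
    simp only [outerRun, PMF.support_pure, Set.mem_singleton_iff] at hs
    subst hs
    exact ⟨hβ, hθ, hρ, rfl⟩
  | succ t ih =>
    intro s hs
    rw [outerRun, PMF.mem_support_bind_iff] at hs
    obtain ⟨s', hs', hs⟩ := hs
    obtain ⟨-, h2, h3, h4⟩ := ih s' hs'
    rw [outerStep_eq, PMF.mem_support_bind_iff] at hs
    obtain ⟨u, hu, hs⟩ := hs
    rw [PMF.mem_support_map_iff] at hs
    obtain ⟨w, -, rfl⟩ := hs
    obtain ⟨h5, h6⟩ := innerRun_average_bounds h2 h3 hu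
    exact ⟨norm_projBall_le ((norm_nonneg _).trans hβ) _, h5, h6, by simp [h4]⟩

theorem outputLaw_eq (M : MDP X A) (φ : X → A → Vec d) (μB : stdSimplex ℝ (X × A))
    (I : AlgInput d) (T : ℕ+) :
    outputLaw M φ μB I T = (outerRun M φ μB I T).bind fun s =>
      PMF.map (fun j : Fin T => policyOf φ I.α (s.hist.take (j : ℕ)))
        (PMF.uniformOfFintype (Fin T)) := by
  unfold outputLaw
  congr 1
  funext s
  exact PMF.map_comp (fun j : Fin T => (j : ℕ)) (PMF.uniformOfFintype (Fin T))
    fun j : ℕ => policyOf φ I.α (s.hist.take j)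

/-- Error incurred by one round. -/
noncomputable def roundError (I : AlgInput d) (D H G : ℝ) : ℝ :=
  ((2 * I.η * D ^ 2 + I.ξ) * H + I.ξ) + (2 * I.Dθ ^ 2 / I.η + 1 / (2 * I.ξ)) / I.K +
    I.ζ / 2 * (1 + 2 * D * I.Dθ) ^ 2 * G + I.α * (D * I.Dθ) ^ 2

namespace RegretSetup

variable {M : MDP X A} {φ : X → A → Vec d} {μB : stdSimplex ℝ (X × A)} {I : AlgInput d}
  {ρ : Policy X A → ℝ} {πs : Policy X A} {ν : stdSimplex ℝ X} {βs : Vec d} {R D H G : ℝ}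

/-- The per-round gap is the sum of the three regrets. Those of β and of the policy are offset by
their potentials; that of the inner loop goes entirely into the round error. The inner comparator is
the Bellman pair of the current policy and so may change every round. -/
theorem expect_outerStep_le (h : RegretSetup M φ μB I ρ πs ν βs R D H G) {s : OuterState d}
    (hβ : ‖s.β‖ ≤ I.Dβ) (hθ : ‖s.θ‖ ≤ I.Dθ) (hρ : s.ρ ∈ Set.Icc (0 : ℝ) 1) :
    (outerStep M φ μB I s).expect (outerPotential φ I ρ πs ν βs R) ≤
      outerPotential φ I ρ πs ν βs R s + roundError I D H G := by
  set π := policyOf φ I.α s.hist with hπ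
  obtain ⟨θs, hbell, hθs⟩ := h.bellman π
  have hsfin := support_sampleLaw_finite M μB
  have hifin := support_innerRun_finite M φ μB I π s.β s.θ s.ρ I.K
  have hinner := expect_innerRun_average_le (M := M) π h.η_pos h.ξ_pos h.norm_feat
    (h.sq_impWeight s.β hβ) hθs (h.gain_mem π) hθ hρ
  have hstar := gradTheta_add_gradRho_mul M φ μB I.c π s.β θs (ρ π)
  rw [weightedTD_eq_zero hbell] at hstar
  rw [outerStep_eq, PMF.expect_bind hifin fun u => PMF.support_map_finite hsfin _]
  set k : ℝ := outerPotential φ I ρ πs ν βs R s - (gradTheta M φ μB I.c π s.β θs +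
    gradRho φ μB I.c s.β * ρ π) + I.ζ / 2 * (1 + 2 * D * I.Dθ) ^ 2 * G +
      I.α * (D * I.Dθ) ^ 2 with hk
  have hpt : ∀ u ∈ (innerRun M φ μB I π s.β s.θ s.ρ I.K).support,
      ((sampleLaw M μB).map fun w =>
          ({ β := projBall I.Dβ (s.β + I.ζ • (tdError M φ π
              ((1 / (I.K : ℝ)) • u.sumθ) ((1 / (I.K : ℝ)) * u.sumρ) w •
                scaled φ μB I.c (φ w.1 w.2.1)))
             θ := (1 / (I.K : ℝ)) • u.sumθ
             ρ := (1 / (I.K : ℝ)) * u.sumρ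
             hist := s.hist ++ [(1 / (I.K : ℝ)) • u.sumθ] } : OuterState d)).expect
        (outerPotential φ I ρ πs ν βs R) ≤
      k + (gradTheta M φ μB I.c π s.β ((1 / (I.K : ℝ)) • u.sumθ) +
          gradRho φ μB I.c s.β * ((1 / (I.K : ℝ)) * u.sumρ)) := by
    intro u hu
    obtain ⟨hθt, hρt⟩ := innerRun_average_bounds hθ hρ hu
    set θt := (1 / (I.K : ℝ)) • u.sumθ
    set ρt := (1 / (I.K : ℝ)) * u.sumρ
    have hb := expect_betaStep_le (M := M) (c := I.c) h.ζ_pos h.norm_feat h.sq_scaled π hθt hρt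
      h.norm_comparator s.β
    have hp := policyPotential_add_le h.α_pos h.norm_feat h.α_mul_le πs ν hθt s.hist.sum
    have ht := gradTheta_add_gradRho_mul M φ μB I.c π s.β θt ρt
    have hc := h.comparator π θt ρt
    rw [PMF.expect_map hsfin]
    -- Appending keeps the old prefixes, so the only new summand belongs to the policy just used,
    -- not to the one built from θt.
    have hsum : ∑ j ∈ Finset.range (s.hist ++ [θt]).length,
        (R - ρ (policyOf φ I.α ((s.hist ++ [θt]).take j))) =
        ∑ j ∈ Finset.range s.hist.length, (R - ρ (policyOf φ I.α (s.hist.take j))) +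
          (R - ρ π) := by
      rw [List.length_append, List.length_singleton, Finset.sum_range_succ, List.take_left]
      congr 1
      refine Finset.sum_congr rfl fun j hj => ?_
      rw [List.take_append_of_le_length (Finset.mem_range.1 hj).le]
    simp only [outerPotential, hsum, List.sum_append, List.sum_singleton]
    rw [PMF.expect_add hsfin, PMF.expect_add hsfin, PMF.expect_const, PMF.expect_const]
    have hπ' : softmaxPolicy φ I.α s.hist.sum = π := rfl
    rw [hπ'] at hp
    simp only [hk, outerPotential]
    linarith
  refine (PMF.expect_mono hifin hpt).trans ?_
  rw [PMF.expect_add hifin, PMF.expect_const]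
  simp only [hk, roundError]
  linarith

theorem expect_outerRun_le (h : RegretSetup M φ μB I ρ πs ν βs R D H G) (t : ℕ) :
    (outerRun M φ μB I t).expect (outerPotential φ I ρ πs ν βs R) ≤
      2 * I.Dβ ^ 2 / I.ζ + Real.log (Fintype.card A) / I.α + t * roundError I D H G := by
  induction t with
  | zero =>
    have h1 : ‖I.β₁ - βs‖ ^ 2 / (2 * I.ζ) ≤ 2 * I.Dβ ^ 2 / I.ζ := by
      have := h.ζ_pos
      rw [div_le_div_iff₀ (by positivity) this]
      nlinarith [norm_sub_sq_le_of_norm_le h.norm_β₁ h.norm_comparator]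
    rw [outerRun, PMF.expect_pure]
    simp only [outerPotential, List.length_nil, Finset.range_zero, Finset.sum_empty, zero_add,
      List.sum_nil, policyPotential_zero, Nat.cast_zero, zero_mul, add_zero]
    linarith
  | succ t ih =>
    have hfin := support_outerRun_finite M φ μB I t
    rw [outerRun, PMF.expect_bind hfin (support_outerStep_finite M φ μB I)]
    refine (PMF.expect_mono hfin fun s hs => ?_).trans (b := (outerRun M φ μB I t).expect fun s =>
      outerPotential φ I ρ πs ν βs R s + roundError I D H G) ?_
    · obtain ⟨h1, h2, h3, -⟩ := outerRun_support_bounds h.norm_β₁ h.norm_θ₀ h.ρ₀_mem t s hs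
      exact h.expect_outerStep_le h1 h2 h3
    · rw [PMF.expect_add hfin, PMF.expect_const]
      push_cast
      linarith

/-- Expected suboptimality of the output policy. -/
theorem expect_outputLaw_le (h : RegretSetup M φ μB I ρ πs ν βs R D H G) (T : ℕ+) :
    (outputLaw M φ μB I T).expect (fun π => R - ρ π) ≤
      (2 * I.Dβ ^ 2 / I.ζ + Real.log (Fintype.card A) / I.α) / T + roundError I D H G := by
  have hfin := support_outerRun_finite M φ μB I T
  have hT : (0 : ℝ) < (T : ℕ) := by exact_mod_cast T.pos
  have : Nonempty (Fin T) := ⟨⟨0, T.pos⟩⟩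
  have hrun := h.expect_outerRun_le T
  rw [outputLaw_eq, PMF.expect_bind hfin fun s => PMF.support_map_finite (Set.toFinite _) _]
  have h1 : (outerRun M φ μB I T).expect (fun s =>
      (PMF.map (fun j : Fin T => policyOf φ I.α (s.hist.take (j : ℕ)))
        (PMF.uniformOfFintype (Fin T))).expect fun π => R - ρ π) ≤
      (outerRun M φ μB I T).expect fun s =>
        ((T : ℕ) : ℝ)⁻¹ * outerPotential φ I ρ πs ν βs R s := by
    refine PMF.expect_mono hfin fun s hs => ?_
    obtain ⟨-, -, -, hlen⟩ := outerRun_support_bounds h.norm_β₁ h.norm_θ₀ h.ρ₀_mem T s hs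
    rw [PMF.expect_map (Set.toFinite _), expect_uniformOfFintype, Fintype.card_fin]
    refine mul_le_mul_of_nonneg_left ?_ (by positivity)
    rw [Fin.sum_univ_eq_sum_range (fun j => R - ρ (policyOf φ I.α (s.hist.take j))),
      outerPotential, hlen]
    -- Both final potentials are nonnegative, so the accumulated gap is at most the outer potential.
    have h2 := policyPotential_nonneg φ h.α_pos πs ν s.hist.sum
    have h3 : 0 ≤ ‖s.β - βs‖ ^ 2 / (2 * I.ζ) := by
      have := h.ζ_pos
      positivity
    linarith
  refine h1.trans ?_
  rw [PMF.expect_const_mul, inv_mul_le_iff₀ hT]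
  refine hrun.trans_eq ?_
  field_simp

end RegretSetup

end OuterLoop

/-! ### Step sizes and iteration counts. -/

section Tuning

/-- One is added to the ceiling to stay positive at x = 0, whence the slack 2. -/
theorem exists_pnat_between {x : ℝ} (hx : 0 ≤ x) : ∃ n : ℕ+, x ≤ (n : ℕ) ∧ ((n : ℕ) : ℝ) ≤ x + 2 := by
  refine ⟨⟨⌈x⌉₊ + 1, Nat.succ_pos _⟩, ?_, ?_⟩
  · push_cast [PNat.mk_coe]
    linarith [Nat.le_ceil x]
  · push_cast [PNat.mk_coe]
    linarith [Nat.ceil_lt_add_one hx]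

theorem div_mul_le_of_le {ε k Q y : ℝ} (hε : 0 < ε) (hk : 0 < k) (hQ : 0 < Q) (hy : y ≤ Q) :
    ε / (k * Q) * y ≤ ε / k := by
  rw [div_mul_eq_mul_div, div_le_div_iff₀ (by positivity) hk]
  nlinarith [mul_le_mul_of_nonneg_left hy (mul_pos hε hk).le]

/-- The step sizes and iteration numbers make the regret bound at most `ε`. -/
theorem regret_budget {d : ℕ} {I : AlgInput d} {ε D H G ℓ : ℝ} {T : ℕ+} (hε : 0 < ε)
    (hH : 0 ≤ H) (hG : 0 ≤ G)
    (hη : I.η = ε / (8 * (1 + 2 * D ^ 2 * H))) (hξ : I.ξ = ε / (8 * (1 + H)))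
    (hζ : I.ζ = ε / (4 * (1 + (1 + 2 * D * I.Dθ) ^ 2 * G)))
    (hα : I.α = ε / (8 * (1 + (D * I.Dθ) ^ 2)))
    (hK : 8 * (16 * I.Dθ ^ 2 * (1 + 2 * D ^ 2 * H) + 4 * (1 + H)) / ε ^ 2 ≤ (I.K : ℕ))
    (hT : 64 * (I.Dβ ^ 2 * (1 + (1 + 2 * D * I.Dθ) ^ 2 * G) + (1 + (D * I.Dθ) ^ 2) * ℓ) / ε ^ 2 ≤
      (T : ℕ)) :
    (2 * I.Dβ ^ 2 / I.ζ + ℓ / I.α) / T + roundError I D H G ≤ ε := by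
  have hKpos : (0 : ℝ) < (I.K : ℕ) := by exact_mod_cast I.K.pos
  have hTpos : (0 : ℝ) < (T : ℕ) := by exact_mod_cast T.pos
  obtain ⟨Qθ, hQθ⟩ : ∃ Q, Q = 1 + 2 * D ^ 2 * H := ⟨_, rfl⟩
  obtain ⟨Qβ, hQβ⟩ : ∃ Q, Q = 1 + (1 + 2 * D * I.Dθ) ^ 2 * G := ⟨_, rfl⟩
  obtain ⟨Qα, hQα⟩ : ∃ Q, Q = 1 + (D * I.Dθ) ^ 2 := ⟨_, rfl⟩
  have hQθ0 : 0 < Qθ := by rw [hQθ]; positivity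
  have hQβ0 : 0 < Qβ := by rw [hQβ]; positivity
  have hQα0 : 0 < Qα := by rw [hQα]; positivity
  have hQρ0 : 0 < 1 + H := by positivity
  rw [← hQθ] at hη hK
  rw [← hQβ] at hζ hT
  rw [← hQα] at hα hT
  -- Six errors of at most ε/8 each; `t3` allows ε/4 because ζ enters halved. The added 1 in each
  -- denominator keeps the step sizes finite when D, H or G vanishes.
  have t1 : I.η * (2 * D ^ 2 * H) ≤ ε / 8 := by
    rw [hη]; exact div_mul_le_of_le hε (by norm_num) hQθ0 (by linarith)
  have t2 : I.ξ * (1 + H) ≤ ε / 8 := by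
    rw [hξ]; exact div_mul_le_of_le hε (by norm_num) hQρ0 le_rfl
  have t3 : I.ζ * ((1 + 2 * D * I.Dθ) ^ 2 * G) ≤ ε / 4 := by
    rw [hζ]; exact div_mul_le_of_le hε (by norm_num) hQβ0 (by linarith)
  have t4 : I.α * (D * I.Dθ) ^ 2 ≤ ε / 8 := by
    rw [hα]; exact div_mul_le_of_le hε (by norm_num) hQα0 (by linarith)
  have t5 : (2 * I.Dθ ^ 2 / I.η + 1 / (2 * I.ξ)) / (I.K : ℕ) ≤ ε / 8 := by
    rw [div_le_iff₀ hKpos]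
    rw [div_le_iff₀ (by positivity)] at hK
    have e : 2 * I.Dθ ^ 2 / I.η + 1 / (2 * I.ξ) =
        (16 * I.Dθ ^ 2 * Qθ + 4 * (1 + H)) / ε := by
      rw [hη, hξ]
      field_simp
      ring
    rw [e, div_le_iff₀ hε]
    nlinarith
  have t6 : (2 * I.Dβ ^ 2 / I.ζ + ℓ / I.α) / (T : ℕ) ≤ ε / 8 := by
    rw [div_le_iff₀ hTpos]
    rw [div_le_iff₀ (by positivity)] at hT
    have e : 2 * I.Dβ ^ 2 / I.ζ + ℓ / I.α = 8 * (I.Dβ ^ 2 * Qβ + Qα * ℓ) / ε := by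
      rw [hζ, hα]
      field_simp
      ring
    rw [e, div_le_iff₀ hε]
    nlinarith
  rw [roundError]
  nlinarith

/-- Size of the number of inner iterations. -/
theorem inner_iterations_le {ε b κ κθ D Dθ Dβ C E H k : ℝ} (hε : 0 < ε) (hε1 : ε ≤ 1)
    (hb : 1 + D ^ 2 ≤ b) (hE : 1 ≤ E) (hbC : 1 ≤ b * C) (hDθ : Dθ ^ 2 ≤ κθ ^ 2 * E)
    (hDβ : Dβ ^ 2 = κ ^ 2 * C) (hH : H = (1 + D ^ 2) * Dβ ^ 2)
    (hk : k ≤ 8 * (16 * Dθ ^ 2 * (1 + 2 * D ^ 2 * H) + 4 * (1 + H)) / ε ^ 2 + 2) :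
    k + 1 ≤ (128 * κθ ^ 2 * (b + 2 * b ^ 2 * κ ^ 2) + 32 * (b + b * κ ^ 2) + 3 * b) *
      (C * E) / ε ^ 2 := by
  have hb0 : 0 < b := by nlinarith [sq_nonneg D]
  have hC : 0 < C := by
    by_contra hC
    nlinarith [mul_nonneg hb0.le (neg_nonneg.2 (not_lt.1 hC))]
  have hHle : H ≤ b * κ ^ 2 * C := by
    rw [hH, hDβ, mul_assoc]
    exact mul_le_mul_of_nonneg_right hb (by positivity)
  have hH0 : 0 ≤ H := by rw [hH]; positivity
  have hQθ : 1 + 2 * D ^ 2 * H ≤ (b + 2 * b ^ 2 * κ ^ 2) * C := by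
    have h1 : D ^ 2 * H ≤ b * (b * κ ^ 2 * C) :=
      mul_le_mul (by linarith) hHle hH0 hb0.le
    nlinarith
  have hQρ : 1 + H ≤ (b + b * κ ^ 2) * C * E := by
    have h1 : 1 + H ≤ (b + b * κ ^ 2) * C := by nlinarith
    have h2 : 0 ≤ (b + b * κ ^ 2) * C := by positivity
    nlinarith
  have h1 : Dθ ^ 2 * (1 + 2 * D ^ 2 * H) ≤ κθ ^ 2 * E * ((b + 2 * b ^ 2 * κ ^ 2) * C) :=
    mul_le_mul hDθ hQθ (by positivity) (by positivity)
  -- Absorbs the rounding slack 2 and the one extra sample per round; together they give the term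
  -- 3b.
  have h2 : ε ^ 2 ≤ b * C * E := by
    have : ε ^ 2 ≤ 1 := pow_le_one₀ hε.le hε1
    nlinarith
  rw [le_div_iff₀ (by positivity)]
  have h3 : k * ε ^ 2 ≤ 8 * (16 * Dθ ^ 2 * (1 + 2 * D ^ 2 * H) + 4 * (1 + H)) + 2 * ε ^ 2 := by
    refine (mul_le_mul_of_nonneg_right hk (by positivity)).trans_eq ?_
    field_simp
  nlinarith

/-- Size of the number of rounds. -/
theorem outer_iterations_le {ε b κ κθ D Dθ Dβ C E G N ℓ k : ℝ} (hε : 0 < ε) (hε1 : ε ≤ 1)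
    (hb : 1 + D ^ 2 ≤ b) (hE : 1 ≤ E) (hN : 1 ≤ N) (hℓ : 1 ≤ 2 * ℓ) (hbC : 1 ≤ b * C)
    (hDθ : Dθ ^ 2 ≤ κθ ^ 2 * E) (hDβ : Dβ ^ 2 = κ ^ 2 * C) (hG : G = (1 + D ^ 2) * N)
    (hk : k ≤ 64 * (Dβ ^ 2 * (1 + (1 + 2 * D * Dθ) ^ 2 * G) + (1 + (D * Dθ) ^ 2) * ℓ) / ε ^ 2 + 2) :
    k ≤ (64 * (2 * κ ^ 2 * (1 + (2 + 8 * b * κθ ^ 2) * b) + b * (1 + b * κθ ^ 2)) + 4 * b) *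
      (C * E * N * ℓ) / ε ^ 2 := by
  have hb0 : 0 < b := by nlinarith [sq_nonneg D]
  have hℓ0 : 0 < ℓ := by linarith
  have hC : 0 < C := by
    by_contra hC
    nlinarith [mul_nonneg hb0.le (neg_nonneg.2 (not_lt.1 hC))]
  have hG0 : 0 ≤ G := by rw [hG]; positivity
  have hGle : G ≤ b * N := by
    rw [hG]
    exact mul_le_mul_of_nonneg_right hb (by linarith)
  have hDD : (D * Dθ) ^ 2 ≤ b * κθ ^ 2 * E := by
    rw [mul_pow, mul_assoc]
    exact mul_le_mul (by linarith) hDθ (sq_nonneg _) hb0.le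
  -- Uses (1 + y)² ≤ 2 + 2y² and E ≥ 1.
  have hsq : (1 + 2 * D * Dθ) ^ 2 ≤ (2 + 8 * b * κθ ^ 2) * E := by
    nlinarith [sq_nonneg (1 - 2 * D * Dθ)]
  have hEN : 1 ≤ E * N := one_le_mul_of_one_le_of_one_le hE hN
  have hQβ : 1 + (1 + 2 * D * Dθ) ^ 2 * G ≤ (1 + (2 + 8 * b * κθ ^ 2) * b) * (E * N) := by
    have h1 : (1 + 2 * D * Dθ) ^ 2 * G ≤ (2 + 8 * b * κθ ^ 2) * E * (b * N) :=
      mul_le_mul hsq hGle hG0 (by positivity)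
    nlinarith
  have hQα : 1 + (D * Dθ) ^ 2 ≤ (1 + b * κθ ^ 2) * E := by nlinarith
  -- This term carries no logarithm; the factor 2 comes from 1 ≤ 2ℓ.
  have hβ : Dβ ^ 2 * (1 + (1 + 2 * D * Dθ) ^ 2 * G) ≤
      2 * κ ^ 2 * (1 + (2 + 8 * b * κθ ^ 2) * b) * (C * E * N * ℓ) := by
    have h1 : Dβ ^ 2 * (1 + (1 + 2 * D * Dθ) ^ 2 * G) ≤
        κ ^ 2 * C * ((1 + (2 + 8 * b * κθ ^ 2) * b) * (E * N)) := by
      rw [hDβ]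
      exact mul_le_mul_of_nonneg_left hQβ (by positivity)
    have h2 : 0 ≤ κ ^ 2 * C * ((1 + (2 + 8 * b * κθ ^ 2) * b) * (E * N)) := by positivity
    nlinarith
  have hα : (1 + (D * Dθ) ^ 2) * ℓ ≤ b * (1 + b * κθ ^ 2) * (C * E * N * ℓ) := by
    have h1 : (1 + (D * Dθ) ^ 2) * ℓ ≤ (1 + b * κθ ^ 2) * E * ℓ :=
      mul_le_mul_of_nonneg_right hQα hℓ0.le
    have h2 : 0 ≤ (1 + b * κθ ^ 2) * E * ℓ := by positivity
    have h3 : 1 ≤ b * C * N := one_le_mul_of_one_le_of_one_le hbC hN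
    nlinarith
  have h2 : ε ^ 2 ≤ 2 * b * (C * E * N * ℓ) := by
    have h3 : ε ^ 2 ≤ 1 := pow_le_one₀ hε.le hε1
    have h4 : 1 ≤ b * C * (E * N) * (2 * ℓ) :=
      one_le_mul_of_one_le_of_one_le (one_le_mul_of_one_le_of_one_le hbC hEN) hℓ
    nlinarith
  rw [le_div_iff₀ (by positivity)]
  have h3 : k * ε ^ 2 ≤ 64 * (Dβ ^ 2 * (1 + (1 + 2 * D * Dθ) ^ 2 * G) +
      (1 + (D * Dθ) ^ 2) * ℓ) + 2 * ε ^ 2 := by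
    refine (mul_le_mul_of_nonneg_right hk (by positivity)).trans_eq ?_
    field_simp
  linarith

end Tuning

/-! ### Assembly of the two statements. -/

theorem corollary2 :
    -- the size of the parameters of the action-value functions
    (∀ (X : Type*) (A : Type*) [Fintype X] [Fintype A] (d : ℕ) (M : MDP X A)
        (φ : X → A → Vec d) (ψ : X → Vec d) (ω : Vec d) (Dφ Dq : ℝ) (ρ : Policy X A → ℝ),
        M.IsLinear φ ψ ω Dφ (√d) (√d) →
        (∀ v : X → ℝ, (∀ x, |v x| ≤ 1) → ‖∑ x, v x • ψ x‖ ≤ √d) →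
        (∀ π x, M.avgReward π x = ρ π) →
        1 ≤ Dq →
        (∀ π, ∃ q, M.IsBellman π (ρ π) q ∧ ∀ x a x' a', q x a - q x' a' < Dq) →
        ∀ π, ∃ θ : Vec d, M.IsBellman π (ρ π) (fun x a => inner ℝ (φ x a) θ) ∧
          ‖θ‖ ≤ √d + 1 + √d * Dq) ∧
    -- the sample complexity
    (∀ Bφ κ κθ : ℝ, 0 < Bφ → 0 < κ → 0 < κθ → ∃ C₀ : ℝ, 0 < C₀ ∧
      ∀ (c : ℝ) (d nA : ℕ) (Dφ Dθ Dβ ε : ℝ), (c = 1 / 2 ∨ c = 1) → 2 ≤ nA → Dφ ≤ Bφ →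
        0 < ε → ε ≤ 1 →
      ∃ (T K : ℕ+) (ζ α ξ η : ℝ), 0 < ζ ∧ 0 < α ∧ 0 < ξ ∧ 0 < η ∧
      ∀ (X : Type*) (A : Type*) [Fintype X] [Fintype A] [Nonempty A], Fintype.card A = nA →
      ∀ (M : MDP X A) (φ : X → A → Vec d) (ψ : X → Vec d) (ω : Vec d) (Dq : ℝ)
        (ρ : Policy X A → ℝ) (occ : Policy X A → stdSimplex ℝ (X × A)) (πstar πB : Policy X A)
        (β₁ θ₀ : Vec d) (ρ₀ : ℝ),
        M.IsLinear φ ψ ω Dφ (√d) (√d) →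
        (∀ π x, M.avgReward π x = ρ π) →
        (∀ π, M.IsOccupancy π (occ π)) →
        1 ≤ Dq →
        (∀ π, ∃ q, M.IsBellman π (ρ π) q ∧ ∀ x a x' a', q x a - q x' a' < Dq) →
        (∀ π, ∃ θ : Vec d, M.IsBellman π (ρ π) (fun x a => inner ℝ (φ x a) θ) ∧ ‖θ‖ ≤ Dθ) →
        Dθ ≤ κθ * (√d * Dq) →
        IsUnit (featCov φ (occ πB)) →
        √(coverage φ c (occ πstar) (occ πB)) ≤ Dβ →
        Dβ = κ * √(coverage φ c (occ πstar) (occ πB)) →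
        ‖β₁‖ ≤ Dβ → ‖θ₀‖ ≤ Dθ → ρ₀ ∈ Set.Icc (0 : ℝ) 1 →
        (outputLaw M φ (occ πB) ⟨c, Dθ, Dβ, ζ, α, ξ, η, K, β₁, θ₀, ρ₀⟩ T).expect
            (fun π => ∑ x, ∑ a, (occ πstar (x, a) - occ π (x, a)) * M.r x a) ≤ ε ∧
          (numSamples T K : ℝ) ≤ C₀ * (ε ^ (-4 : ℤ) * Dq ^ 4 *
            coverage φ c (occ πstar) (occ πB) ^ 2 * (d : ℝ) ^ (4 - 2 * c) *
            Real.log nA)) := by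
  constructor
  · intro X A _ _ d M φ ψ ω Dφ Dq ρ hlin hψ _ hDq hq π
    obtain ⟨q, hq, hspan⟩ := hq π
    obtain ⟨θ, h1, h2⟩ := hlin.exists_bellman_param hψ (by linarith) hq hspan
    exact ⟨θ, h1, by linarith⟩
  intro B κ κθ hB hκ hκθ
  obtain ⟨b, hb⟩ : ∃ b, b = 1 + B ^ 2 := ⟨_, rfl⟩
  have hb0 : 0 < b := by rw [hb]; positivity
  refine ⟨(128 * κθ ^ 2 * (b + 2 * b ^ 2 * κ ^ 2) + 32 * (b + b * κ ^ 2) + 3 * b) *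
    (64 * (2 * κ ^ 2 * (1 + (2 + 8 * b * κθ ^ 2) * b) + b * (1 + b * κθ ^ 2)) + 4 * b),
    by positivity, ?_⟩
  intro c d nA D Dθ Dβ ε hc hnA hDB hε hε1
  obtain ⟨H, hH⟩ : ∃ H, H = (1 + D ^ 2) * Dβ ^ 2 := ⟨_, rfl⟩
  obtain ⟨N, hN⟩ : ∃ N, N = (d : ℝ) ^ (2 - 2 * c) := ⟨_, rfl⟩
  obtain ⟨G, hG⟩ : ∃ G, G = (1 + D ^ 2) * N := ⟨_, rfl⟩
  have hN0 : 0 ≤ N := by rw [hN]; positivity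
  have hH0 : 0 ≤ H := by rw [hH]; positivity
  have hG0 : 0 ≤ G := by rw [hG]; positivity
  have hlog : 1 ≤ 2 * Real.log nA := by
    have h1 : Real.log 2 ≤ Real.log nA :=
      Real.log_le_log (by norm_num) (by exact_mod_cast hnA)
    linarith [Real.log_two_gt_d9]
  have hlog0 : 0 ≤ Real.log nA := by linarith
  obtain ⟨K, hK1, hK2⟩ := exists_pnat_between (x :=
    8 * (16 * Dθ ^ 2 * (1 + 2 * D ^ 2 * H) + 4 * (1 + H)) / ε ^ 2) (by positivity)
  obtain ⟨T, hT1, hT2⟩ := exists_pnat_between (x :=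
    64 * (Dβ ^ 2 * (1 + (1 + 2 * D * Dθ) ^ 2 * G) + (1 + (D * Dθ) ^ 2) * Real.log nA) / ε ^ 2)
    (by positivity)
  refine ⟨T, K, ε / (4 * (1 + (1 + 2 * D * Dθ) ^ 2 * G)), ε / (8 * (1 + (D * Dθ) ^ 2)),
    ε / (8 * (1 + H)), ε / (8 * (1 + 2 * D ^ 2 * H)), by positivity, by positivity, by positivity,
    by positivity, ?_⟩
  intro X A _ _ _ hA M φ ψ ω Dq ρ occ πs πB β₁ θ₀ ρ₀ hlin _ hocc hDq _ hbell hDθ hunit hcov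
    hDβ hβ₁ hθ₀ hρ₀
  obtain ⟨βs, hβs, htrans⟩ := exists_comparator hunit c (occ πs)
  obtain ⟨ν, hν1, hν2⟩ := hocc πs
  have hgain : ∀ π, ∑ z : X × A, occ π z * M.r z.1 z.2 = ρ π := fun π => by
    obtain ⟨θ, h1, -⟩ := hbell π
    exact (hocc π).sum_reward h1
  have hDβ0 : 0 ≤ Dβ := (norm_nonneg _).trans hβ₁
  have hDθ0 : 0 ≤ Dθ := (norm_nonneg _).trans hθ₀
  -- An occupancy measure has mass one, so it cannot live on an empty type.
  obtain ⟨⟨x₀, a₀⟩⟩ : Nonempty (X × A) := by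
    by_contra hne
    have := stdSimplex_sum (occ πs)
    rw [not_nonempty_iff] at hne
    simp at this
  have hD0 : 0 ≤ D := (norm_nonneg _).trans (hlin.norm_feat x₀ a₀)
  -- In dimension 0 every inner product vanishes, but ⟨φ, ∑ψ⟩ = 1.
  have hd : (1 : ℝ) ≤ d := by
    rcases Nat.eq_zero_or_pos d with rfl | hd
    · have h1 := hlin.inner_sum_psi x₀ a₀
      simp [PiLp.inner_apply] at h1
    · exact_mod_cast hd
  have hgap : (fun π => ∑ x, ∑ a, (occ πs (x, a) - occ π (x, a)) * M.r x a) =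
      fun π => ρ πs - ρ π := by
    funext π
    rw [← hgain, ← hgain π, ← Finset.sum_sub_distrib, Fintype.sum_prod_type]
    exact Finset.sum_congr rfl fun x _ => Finset.sum_congr rfl fun a _ => by ring
  constructor
  · have hsetup : RegretSetup M φ (occ πB) ⟨c, Dθ, Dβ, ε / (4 * (1 + (1 + 2 * D * Dθ) ^ 2 * G)),
        ε / (8 * (1 + (D * Dθ) ^ 2)), ε / (8 * (1 + H)), ε / (8 * (1 + 2 * D ^ 2 * H)), K, β₁, θ₀,
        ρ₀⟩ ρ πs ν βs (ρ πs) D H G :=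
      { η_pos := by positivity
        ξ_pos := by positivity
        ζ_pos := by positivity
        α_pos := by positivity
        α_mul_le := by
          refine (div_mul_le_of_le hε (by norm_num) (by positivity) ?_).trans
            (by linarith : ε / 8 ≤ 1)
          -- y ≤ 1 + y², so the α fixed by the budget also meets the range condition of the
          -- exponential estimate.
          nlinarith [sq_nonneg (D * Dθ - 1)]
        norm_feat := hlin.norm_feat
        sq_impWeight := fun β hβ => by
          refine (sum_sq_inner_scaled_le hunit hc hlin.norm_feat β).trans ?_
          rw [hH]
          have : ‖β‖ ^ 2 ≤ Dβ ^ 2 := pow_le_pow_left₀ (norm_nonneg _) hβ 2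
          gcongr
        sq_scaled := by
          rw [hG, hN]
          exact sum_norm_sq_scaled_le hunit hc hlin.norm_feat
        norm_comparator := by
          -- The square root of the coverage ratio is the norm of the comparator, so the radius
          -- condition says it is feasible.
          rw [← hβs, Real.sqrt_sq (norm_nonneg _)] at hcov
          exact hcov
        comparator := fun π θ ρ' => by
          rw [← hgain]
          exact weightedTD_comparator hlin htrans hν1 hν2 π θ ρ'
        gain_mem := fun π => by
          rw [← hgain]
          exact ⟨le_stdSimplex_sum_mul _ fun z => (M.r_mem z.1 z.2).1,
            stdSimplex_sum_mul_le _ fun z => (M.r_mem z.1 z.2).2⟩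
        bellman := hbell
        norm_β₁ := hβ₁
        norm_θ₀ := hθ₀
        ρ₀_mem := hρ₀ }
    rw [hgap]
    refine (hsetup.expect_outputLaw_le T).trans ?_
    rw [hA]
    exact regret_budget hε hH0 hG0 rfl rfl rfl rfl hK1 hT1
  · obtain ⟨C, hC⟩ : ∃ C, C = coverage φ c (occ πs) (occ πB) := ⟨_, rfl⟩
    have hC0 : 0 ≤ C := by rw [hC, ← hβs]; positivity
    have hbD : 1 + D ^ 2 ≤ b := by
      rw [hb]
      gcongr
    have hbC : 1 ≤ b * C := by
      refine (one_le_mul_coverage hunit hc hlin.norm_feat hlin.inner_sum_psi (occ πs)).trans ?_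
      rw [← hC]
      exact mul_le_mul_of_nonneg_right hbD hC0
    have hDβ2 : Dβ ^ 2 = κ ^ 2 * C := by
      rw [hDβ, ← hC, mul_pow, Real.sq_sqrt hC0]
    have hDθ2 : Dθ ^ 2 ≤ κθ ^ 2 * (d * Dq ^ 2) := by
      refine (pow_le_pow_left₀ hDθ0 hDθ 2).trans_eq ?_
      rw [mul_pow, mul_pow, Real.sq_sqrt (by linarith)]
    have hE : 1 ≤ d * Dq ^ 2 := one_le_mul_of_one_le_of_one_le hd (one_le_pow₀ hDq)
    have hN1 : 1 ≤ N := by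
      rw [hN]
      exact Real.one_le_rpow hd (by rcases hc with rfl | rfl <;> norm_num)
    have hk := inner_iterations_le hε hε1 hbD hE hbC hDθ2 hDβ2 hH hK2
    have ht := outer_iterations_le hε hε1 hbD hE hN1 hlog hbC hDθ2 hDβ2 hG hT2
    -- One factor d from each of T and K through D_θ², and d^{2-2c} from the variance of the β step.
    have hpow : (d : ℝ) ^ (4 - 2 * c) = d ^ 2 * N := by
      rw [hN, ← Real.rpow_natCast, ← Real.rpow_add (by linarith)]
      congr 1
      push_cast
      ring
    rw [numSamples, ← hC, hpow]
    push_cast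
    refine (mul_le_mul ht hk (by positivity) (le_trans (by positivity) ht)).trans_eq ?_
    rw [zpow_neg]
    field_simp
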